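/- All algebras and spaces are over $\mathbb{C}$, and $\widehat{\otimes}$ is the (completed) projective tensor product of Banach spaces. Let $A$ be a Banach algebra. For a Banach $A$-bimodule $M$ (a Banach space with commuting, associative left and right actions of $A$ that are bounded bilinear maps) and $n\ge 0$, put $C_n(A,M)=M\widehat{\otimes}A^{\widehat{\otimes} n}$, let $C^n(A,M)$ be the space of bounded $n$-linear maps $A^n\to M$, and let $\mathsf d_n:C_{n+1}(A,M)\to C_n(A,M)$ and $\delta_n:C^n(A,M)\to C^{n+1}(A,M)$ be the Hochschild operators \[ \begin{aligned} \mathsf d_n(x\otimes a_1\otimes\cdots\otimes a_{n+1})={}& xa_1\otimes a_2\otimes\cdots\otimes a_{n+1}+\sum_{j=1}^n(-1)^j x\otimes a_1\otimes\cdots\otimes a_ja_{j+1}\otimes\cdots\otimes a_{n+1}\\ &+(-1)^{n+1}a_{n+1}x\otimes a_1\otimes\cdots\otimes a_n,\\ (\delta_nF)(a_1,\dots,a_{n+1})={}& a_1\cdot F(a_2,\dots,a_{n+1})+\sum_{j=1}^n(-1)^jF(a_1,\dots,a_ja_{j+1},\dots,a_{n+1})\\ &+(-1)^{n+1}F(a_1,\dots,a_n)\cdot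 a_{n+1}. \end{aligned} \] For $n\ge1$ let $H_n(A,M)=\ker \mathsf d_{n-1}/\operatorname{im}\mathsf d_n$ and $H^n(A,M)=\ker\delta_n/\operatorname{im}\delta_{n-1}$. Write $C_n(A)=C_n(A,A)$, a left Banach $A$-module via $b\cdot(a_0\otimes a_1\otimes\cdots\otimes a_n)=ba_0\otimes a_1\otimes\cdots\otimes a_n$, and let $A'$ be the dual bimodule of $A$, with $(a\cdot\varphi)(b)=\varphi(ba)$ and $(\varphi\cdot a)(b)=\varphi(ab)$. The bimodule $M$ is symmetric if $a\cdot x=x\cdot a$ for all $a\in A$, $x\in M$, and, for $A$ unital, unit-linked if $1\cdot x=x=x\cdot 1$ for all $x\in M$. **Proposition.** Let $A$ be a unital commutative Banach algebra that is isomorphic as a Banach space (linearly homeomorphic) to $\ell^1(\Omega)$ for some set $\Omega$. The following are equivalent: - (a) $H^n(A,A')=0$ for all $n\ge1$; - (b) $H_n(A,A)=0$ for all $n\ge1$; - (c) the complex $0\leftarrow C_1(A)\xleftarrow{\mathsf d_1}C_2(A)\xleftarrow{\mathsf d_2}\cdots$ splits in the category of Banach spaces, that is, there are bounded linear maps $s_n:C_n(A)\to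 C_{n+1}(A)$ $(n\ge1)$ with $\mathsf d_1s_1=\mathrm{id}$ and $s_n\mathsf d_n+\mathsf d_{n+1}s_{n+1}=\mathrm{id}$ for all $n\ge1$; - (d) the same complex splits in the category of left Banach $A$-modules, that is, the maps $s_n$ in (c) can be chosen to be $A$-module maps; - (e1) $H^n(A,M)=0$ for all $n\ge1$ and every symmetric unit-linked Banach $A$-bimodule $M$; - (e2) $H_n(A,M)=0$ for all $n\ge1$ and every symmetric unit-linked Banach $A$-bimodule $M$. -/

import Mathlib

open scoped TensorProduct

noncomputable section

namespace BanachHochschild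

universe u v w

/-! ### The projective tensor product of two Banach spaces -/

section ProjectiveTensor

variable (E : Type u) (F : Type v)
  [NormedAddCommGroup E] [NormedSpace ℂ E] [NormedAddCommGroup F] [NormedSpace ℂ F]

/-- The algebraic tensor product `E ⊗ F`, to be equipped with the projective seminorm. -/
def AlgTensor : Type (max u v) := E ⊗[ℂ] F

instance : AddCommGroup (AlgTensor E F) := inferInstanceAs (AddCommGroup (E ⊗[ℂ] F))

instance : Module ℂ (AlgTensor E F) := inferInstanceAs (Module ℂ (E ⊗[ℂ] F))

variable {E F}

/-- The elementary tensor `x ⊗ y`. -/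
def AlgTensor.tmul (x : E) (y : F) : AlgTensor E F := x ⊗ₜ[ℂ] y

/-- The finite families `(xᵢ, yᵢ)` with `z = ∑ᵢ xᵢ ⊗ yᵢ`. -/
def AlgTensor.Rep (z : AlgTensor E F) : Type (max u v) :=
  {l : List (E × F) // (l.map fun p => AlgTensor.tmul p.1 p.2).sum = z}

/-- The number `∑ᵢ ‖xᵢ‖ ‖yᵢ‖` attached to a representation. -/
def AlgTensor.Rep.cost {z : AlgTensor E F} (r : AlgTensor.Rep z) : ℝ :=
  (r.1.map fun p => ‖p.1‖ * ‖p.2‖).sum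

theorem AlgTensor.Rep.cost_nonneg {z : AlgTensor E F} (r : AlgTensor.Rep z) : 0 ≤ r.cost := by
  refine List.sum_nonneg fun a ha => ?_
  obtain ⟨p, -, rfl⟩ := List.mem_map.1 ha
  positivity

instance (z : AlgTensor E F) : Nonempty (AlgTensor.Rep z) := by
  refine TensorProduct.induction_on (motive := fun z : E ⊗[ℂ] F =>
    Nonempty (AlgTensor.Rep (E := E) (F := F) z)) z ?_ ?_ ?_
  · exact ⟨⟨[], rfl⟩⟩
  · intro x y
    exact ⟨⟨[(x, y)], (add_zero _)⟩⟩
  · rintro x y ⟨r⟩ ⟨s⟩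
    refine ⟨⟨r.1 ++ s.1, ?_⟩⟩
    rw [List.map_append, List.sum_append, r.2, s.2]
    rfl

/-- The projective norm: the infimum of `∑ᵢ ‖xᵢ‖ ‖yᵢ‖` over all representations
`z = ∑ᵢ xᵢ ⊗ yᵢ`. -/
def AlgTensor.projNorm (z : AlgTensor E F) : ℝ := ⨅ r : AlgTensor.Rep z, r.cost

theorem AlgTensor.bddBelow_cost (z : AlgTensor E F) :
    BddBelow (Set.range fun r : AlgTensor.Rep z => r.cost) :=
  ⟨0, by rintro _ ⟨r, rfl⟩; exact r.cost_nonneg⟩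

theorem AlgTensor.projNorm_le {z : AlgTensor E F} (r : AlgTensor.Rep z) :
    AlgTensor.projNorm z ≤ r.cost :=
  ciInf_le (AlgTensor.bddBelow_cost z) r

theorem AlgTensor.projNorm_tmul_le (x : E) (y : F) :
    AlgTensor.projNorm (AlgTensor.tmul x y) ≤ ‖x‖ * ‖y‖ := by
  refine (AlgTensor.projNorm_le ⟨[(x, y)], by simp⟩).trans (le_of_eq ?_)
  simp [AlgTensor.Rep.cost]

/-- The projective norm as a seminorm. -/
def AlgTensor.projSeminorm : Seminorm ℂ (AlgTensor E F) :=
  Seminorm.ofSMulLE AlgTensor.projNorm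
    (le_antisymm
      ((AlgTensor.projNorm_le ⟨[], rfl⟩).trans (by simp [AlgTensor.Rep.cost]))
      (le_ciInf fun r => r.cost_nonneg))
    (fun x y => le_ciInf_add_ciInf fun r s =>
      (AlgTensor.projNorm_le (z := x + y)
        ⟨r.1 ++ s.1, by rw [List.map_append, List.sum_append, r.2, s.2]⟩).trans
        (by simp [AlgTensor.Rep.cost]))
    (fun c x => by
      rw [AlgTensor.projNorm.eq_def x, Real.mul_iInf_of_nonneg (norm_nonneg _)]
      refine le_ciInf fun r => ?_
      refine (AlgTensor.projNorm_le (z := c • x)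
        ⟨r.1.map fun p => (c • p.1, p.2), ?_⟩).trans (le_of_eq ?_)
      · conv_rhs => rw [← r.2, List.smul_sum]
        rw [List.map_map, List.map_map]
        rfl
      · simp [AlgTensor.Rep.cost, Function.comp_def, norm_smul, mul_assoc, List.sum_map_mul_left])

instance : SeminormedAddCommGroup (AlgTensor E F) :=
  (AlgTensor.projSeminorm (E := E) (F := F)).toAddGroupSeminorm.toSeminormedAddCommGroup

theorem AlgTensor.norm_def (z : AlgTensor E F) : ‖z‖ = AlgTensor.projNorm z := rfl

instance : NormedSpace ℂ (AlgTensor E F) where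
  norm_smul_le c z := (map_smul_eq_mul (AlgTensor.projSeminorm (E := E) (F := F)) c z).le

variable (E F)

/-- The projective tensor product `E ⊗̂ F`: the completion of the algebraic tensor product for the
projective norm. -/
abbrev ProjTensor : Type (max u v) := UniformSpace.Completion (AlgTensor E F)

/-- The canonical bounded bilinear map `(x, y) ↦ x ⊗ y` from `E × F` to `E ⊗̂ F`. -/
def projMk : E →L[ℂ] F →L[ℂ] ProjTensor E F :=
  LinearMap.mkContinuous₂
    (LinearMap.mk₂ ℂ (fun x y => ((AlgTensor.tmul x y : AlgTensor E F) : ProjTensor E F))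
      (fun x x' y => by
        rw [← UniformSpace.Completion.coe_add]
        exact congrArg _ (TensorProduct.add_tmul x x' y))
      (fun c x y => by
        rw [← UniformSpace.Completion.coe_smul]
        exact congrArg _ (TensorProduct.smul_tmul' c x y).symm)
      (fun x y y' => by
        rw [← UniformSpace.Completion.coe_add]
        exact congrArg _ (TensorProduct.tmul_add x y y'))
      (fun c x y => by
        rw [← UniformSpace.Completion.coe_smul]
        exact congrArg _ (TensorProduct.tmul_smul c x y)))
    1
    (fun x y => by
      rw [LinearMap.mk₂_apply, UniformSpace.Completion.norm_coe, one_mul]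
      exact AlgTensor.projNorm_tmul_le x y)

variable {E F}
variable {G : Type w} [NormedAddCommGroup G] [NormedSpace ℂ G]

/-- The linear map on the algebraic tensor product induced by a bounded bilinear map. -/
def algLift (f : E →L[ℂ] F →L[ℂ] G) : AlgTensor E F →ₗ[ℂ] G :=
  TensorProduct.lift (ContinuousLinearMap.toLinearMap₁₂ f)

@[simp]
theorem algLift_tmul (f : E →L[ℂ] F →L[ℂ] G) (x : E) (y : F) :
    algLift f (AlgTensor.tmul x y) = f x y :=
  TensorProduct.lift.tmul x y

theorem norm_algLift_le (f : E →L[ℂ] F →L[ℂ] G) (z : AlgTensor E F) :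
    ‖algLift f z‖ ≤ ‖f‖ * ‖z‖ := by
  rw [AlgTensor.norm_def, AlgTensor.projNorm, Real.mul_iInf_of_nonneg (norm_nonneg f)]
  refine le_ciInf fun r => ?_
  obtain ⟨l, rfl⟩ := r
  simp only [AlgTensor.Rep.cost]
  induction l with
  | nil => simp
  | cons p l ih =>
    simp only [List.map_cons, List.sum_cons, map_add, algLift_tmul, mul_add]
    refine (norm_add_le _ _).trans (add_le_add ?_ ih)
    rw [← mul_assoc]
    exact f.le_opNorm₂ p.1 p.2

variable [CompleteSpace G]

/-- The bounded linear map `E ⊗̂ F → G` induced by a bounded bilinear map `E × F → G`. -/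
def projLift (f : E →L[ℂ] F →L[ℂ] G) : ProjTensor E F →L[ℂ] G :=
  ((algLift f).mkContinuous ‖f‖ (norm_algLift_le f)).fromCompletion

@[simp]
theorem projLift_mk (f : E →L[ℂ] F →L[ℂ] G) (x : E) (y : F) :
    projLift f (projMk E F x y) = f x y :=
  (ContinuousLinearMap.fromCompletion_apply_coe _ _).trans (algLift_tmul f x y)

end ProjectiveTensor

/-! ### Projective tensor powers -/

section Power

variable (A : Type u) [NormedAddCommGroup A] [NormedSpace ℂ A]

/-- The `n`-th projective tensor power of `A`: the completion of the algebraic tensor power for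
the projective norm. For `n = 0` this is `ℂ`. -/
abbrev ProjPower (n : ℕ) : Type u := UniformSpace.Completion (⨂[ℂ] _ : Fin n, A)

/-- The canonical bounded multilinear map `(a₁, …, aₙ) ↦ a₁ ⊗ ⋯ ⊗ aₙ`. -/
def powMk (n : ℕ) : A [×n]→L[ℂ] ProjPower A n :=
  (UniformSpace.Completion.toComplL (𝕜 := ℂ)).compContinuousMultilinearMap
    (PiTensorProduct.tprodL ℂ (E := fun _ : Fin n => A))

variable {A}
variable {n : ℕ} {G : Type w} [NormedAddCommGroup G] [NormedSpace ℂ G] [CompleteSpace G]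

/-- Bounded `n`-linear maps on `A` induce bounded linear maps on the tensor power; this depends
linearly and boundedly on the multilinear map. -/
def powLift : (A [×n]→L[ℂ] G) →L[ℂ] (ProjPower A n →L[ℂ] G) :=
  LinearMap.mkContinuous
    { toFun := fun f => (PiTensorProduct.liftIsometry ℂ (fun _ : Fin n => A) G f).fromCompletion
      map_add' := fun f g => ContinuousLinearMap.fromCompletion_unique _ _ fun x => by simp
      map_smul' := fun c f => ContinuousLinearMap.fromCompletion_unique _ _ fun x => by simp }
    1
    (fun f => by
      refine ContinuousLinearMap.opNorm_le_bound _ (by positivity) fun x => ?_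
      induction x using UniformSpace.Completion.induction_on with
      | hp => exact isClosed_le (by fun_prop) (by fun_prop)
      | ih x =>
        simpa using PiTensorProduct.norm_eval_le_projectiveSeminorm f x)

@[simp]
theorem powLift_mk (f : A [×n]→L[ℂ] G) (a : Fin n → A) : powLift f (powMk A n a) = f a := by
  refine (ContinuousLinearMap.fromCompletion_apply_coe _ _).trans ?_
  simp

end Power

/-! ### Banach bimodules -/

section Bimodule

variable (A : Type u) [NormedRing A] [NormedAlgebra ℂ A]
variable (M : Type v) [NormedAddCommGroup M] [NormedSpace ℂ M]

/-- A Banach `A`-bimodule structure on `M`: `left a x` is `a · x`, `right a x` is `x · a`, and both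
actions are bounded bilinear maps. It is not assumed that the unit of `A` acts as the identity. -/
structure Bimodule where
  left : A →L[ℂ] M →L[ℂ] M
  right : A →L[ℂ] M →L[ℂ] M
  left_mul : ∀ (a b : A) (x : M), left (a * b) x = left a (left b x)
  right_mul : ∀ (a b : A) (x : M), right (a * b) x = right b (right a x)
  left_right : ∀ (a b : A) (x : M), left a (right b x) = right b (left a x)

variable {A M}

/-- `1 · x = x = x · 1` for all `x`. -/
def Bimodule.IsUnitLinked (B : Bimodule A M) : Prop :=
  ∀ x : M, B.left 1 x = x ∧ B.right 1 x = x

/-- `a · x = x · a` for all `a` and `x`. -/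
def Bimodule.IsSymmetric (B : Bimodule A M) : Prop :=
  ∀ (a : A) (x : M), B.left a x = B.right a x

variable (A)

/-- `A` as a bimodule over itself, by multiplication. -/
def Bimodule.regular : Bimodule A A where
  left := ContinuousLinearMap.mul ℂ A
  right := (ContinuousLinearMap.mul ℂ A).flip
  left_mul a b x := by simp [mul_assoc]
  right_mul a b x := by simp [mul_assoc]
  left_right a b x := by simp [mul_assoc]

variable {A}

/-- The dual bimodule `M'`: `(a · φ)(x) = φ(x · a)` and `(φ · a)(x) = φ(a · x)`. -/
def Bimodule.dual (B : Bimodule A M) : Bimodule A (StrongDual ℂ M) where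
  left := ((ContinuousLinearMap.compL ℂ M M ℂ).flip).comp B.right
  right := ((ContinuousLinearMap.compL ℂ M M ℂ).flip).comp B.left
  left_mul a b φ := by ext x; simp [B.right_mul]
  right_mul a b φ := by ext x; simp [B.left_mul]
  left_right a b φ := by ext x; simp [B.left_right]

@[simp]
theorem Bimodule.dual_left_apply (B : Bimodule A M) (a : A) (φ : StrongDual ℂ M) (x : M) :
    B.dual.left a φ x = φ (B.right a x) := rfl

@[simp]
theorem Bimodule.dual_right_apply (B : Bimodule A M) (a : A) (φ : StrongDual ℂ M) (x : M) :
    B.dual.right a φ x = φ (B.left a x) := rfl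

end Bimodule

/-! ### Multiplying two neighbouring arguments -/

section Contract

variable {A : Type u} [NormedRing A]

/-- `(a₀, …, aₙ) ↦ (a₀, …, aⱼ aⱼ₊₁, …, aₙ)`. -/
def mulAt {n : ℕ} (j : Fin n) (a : Fin (n + 1) → A) : Fin n → A :=
  Fin.contractNth j.castSucc (· * ·) a

/-- The effect on the new entry of changing the `i`-th entry of `a` to `x`. -/
def mulAtEntry {n : ℕ} (j : Fin n) (a : Fin (n + 1) → A) (i : Fin (n + 1)) (x : A) : A :=
  if i = j.castSucc then x * a j.succ else if i = j.succ then a j.castSucc * x else x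

theorem mulAt_update {n : ℕ} (j : Fin n) (a : Fin (n + 1) → A) (i : Fin (n + 1)) (x : A) :
    mulAt j (Function.update a i x)
      = Function.update (mulAt j a) (j.predAbove i) (mulAtEntry j a i x) := by
  funext k
  simp only [mulAt, mulAtEntry, Fin.contractNth, Function.update_apply, Fin.predAbove, Fin.ext_iff,
    Fin.lt_def, Fin.val_castSucc, Fin.val_succ]
  split_ifs <;> simp_all <;> first | omega | (obtain rfl : k = j := Fin.ext ‹_›; rfl)

theorem prod_norm_mulAt_le {n : ℕ} (j : Fin n) (a : Fin (n + 1) → A) :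
    ∏ k, ‖mulAt j a k‖ ≤ ∏ i, ‖a i‖ := by
  have h : ∀ k, ‖mulAt j a k‖ ≤
      (if k = j then ‖a j.castSucc‖ else 1) * ‖a (j.castSucc.succAbove k)‖ := by
    intro k
    by_cases hk : k = j
    · subst hk
      rw [mulAt, Fin.contractNth_apply_of_eq _ _ _ _ (by simp), if_pos rfl,
        Fin.succAbove_castSucc_self]
      exact norm_mul_le _ _
    · rw [mulAt, Fin.contractNth_apply_of_ne _ _ _ _
        (by simpa [Fin.ext_iff, eq_comm] using hk), if_neg hk, one_mul]
  refine (Finset.prod_le_prod (fun k _ => norm_nonneg _) fun k _ => h k).trans (le_of_eq ?_)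
  rw [Finset.prod_mul_distrib, Finset.prod_ite_eq', Fin.prod_univ_succAbove _ j.castSucc]
  simp

variable [NormedAlgebra ℂ A] {G : Type w} [NormedAddCommGroup G] [NormedSpace ℂ G]

/-- `F ↦ ((a₀, …, aₙ) ↦ F(a₀, …, aⱼ aⱼ₊₁, …, aₙ))` on bounded multilinear maps. -/
def contract {n : ℕ} (j : Fin n) : (A [×n]→L[ℂ] G) →L[ℂ] (A [×(n + 1)]→L[ℂ] G) :=
  MultilinearMap.mkContinuousLinear
    { toFun := fun f =>
        { toFun := fun a => f (mulAt j a)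
          map_update_add' := by
            intro inst a i x y
            obtain rfl := Subsingleton.elim inst (instDecidableEqFin (n + 1))
            have h : mulAtEntry j a i (x + y) = mulAtEntry j a i x + mulAtEntry j a i y := by
              unfold mulAtEntry
              split_ifs <;> simp [add_mul, mul_add]
            simp only [mulAt_update, h, ContinuousMultilinearMap.map_update_add]
          map_update_smul' := by
            intro inst a i c x
            obtain rfl := Subsingleton.elim inst (instDecidableEqFin (n + 1))
            have h : mulAtEntry j a i (c • x) = c • mulAtEntry j a i x := by
              unfold mulAtEntry
              split_ifs <;> simp
            simp only [mulAt_update, h, ContinuousMultilinearMap.map_update_smul] }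
      map_add' := fun f g => by ext; simp
      map_smul' := fun c f => by ext; simp }
    1
    (fun f a => by
      rw [one_mul]
      exact (f.le_opNorm _).trans
        (mul_le_mul_of_nonneg_left (prod_norm_mulAt_le j a) (norm_nonneg _)))

@[simp]
theorem contract_apply {n : ℕ} (j : Fin n) (f : A [×n]→L[ℂ] G) (a : Fin (n + 1) → A) :
    contract j f a = f (mulAt j a) := rfl

end Contract

/-! ### Hochschild cochains -/

section Cochains

variable {A : Type u} [NormedRing A] [NormedAlgebra ℂ A]
variable {M : Type v} [NormedAddCommGroup M] [NormedSpace ℂ M]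

/-- The bounded `n`-cochains: bounded `n`-linear maps from `A` to `M`. -/
abbrev Cochain (A : Type u) [NormedRing A] [NormedAlgebra ℂ A]
    (M : Type v) [NormedAddCommGroup M] [NormedSpace ℂ M] (n : ℕ) : Type (max u v) :=
  A [×n]→L[ℂ] M

/-- `(a₁, …, aₙ₊₁) ↦ a₁ · F(a₂, …, aₙ₊₁)`. -/
def Bimodule.firstTerm (B : Bimodule A M) (n : ℕ) (F : Cochain A M n) : Cochain A M (n + 1) :=
  ((B.left.flip.compContinuousMultilinearMap F).flipLinear).uncurryLeft

/-- `(a₁, …, aₙ₊₁) ↦ F(a₁, …, aₙ) · aₙ₊₁`. -/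
def Bimodule.lastTerm (B : Bimodule A M) (n : ℕ) (F : Cochain A M n) : Cochain A M (n + 1) :=
  (B.right.flip.compContinuousMultilinearMap F).uncurryRight

theorem Bimodule.firstTerm_apply (B : Bimodule A M) (n : ℕ) (F : Cochain A M n)
    (a : Fin (n + 1) → A) : B.firstTerm n F a = B.left (a 0) (F (Fin.tail a)) := rfl

theorem Bimodule.lastTerm_apply (B : Bimodule A M) (n : ℕ) (F : Cochain A M n)
    (a : Fin (n + 1) → A) : B.lastTerm n F a = B.right (a (Fin.last n)) (F (Fin.init a)) := rfl

/-- The Hochschild coboundary operator `δₙ`. -/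
def Bimodule.coboundary (B : Bimodule A M) (n : ℕ) : Cochain A M n →ₗ[ℂ] Cochain A M (n + 1) where
  toFun F := B.firstTerm n F + ∑ j : Fin n, (-1 : ℂ) ^ ((j : ℕ) + 1) • contract j F
    + (-1 : ℂ) ^ (n + 1) • B.lastTerm n F
  map_add' F F' := by
    have h₁ : B.firstTerm n (F + F') = B.firstTerm n F + B.firstTerm n F' := by
      ext a; simp [firstTerm_apply]
    have h₂ : B.lastTerm n (F + F') = B.lastTerm n F + B.lastTerm n F' := by
      ext a; simp [lastTerm_apply]
    simp only [h₁, h₂, map_add, smul_add, Finset.sum_add_distrib]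
    abel
  map_smul' c F := by
    have h₁ : B.firstTerm n (c • F) = c • B.firstTerm n F := by
      ext a; simp [firstTerm_apply]
    have h₂ : B.lastTerm n (c • F) = c • B.lastTerm n F := by
      ext a; simp [lastTerm_apply]
    simp only [h₁, h₂, map_smul, smul_add, Finset.smul_sum, RingHom.id_apply, smul_comm c]

theorem Bimodule.coboundary_apply (B : Bimodule A M) (n : ℕ) (F : Cochain A M n)
    (a : Fin (n + 1) → A) :
    B.coboundary n F a = B.left (a 0) (F (Fin.tail a))
      + ∑ j : Fin n, (-1 : ℂ) ^ ((j : ℕ) + 1) • F (mulAt j a)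
      + (-1 : ℂ) ^ (n + 1) • B.right (a (Fin.last n)) (F (Fin.init a)) := by
  simp only [Bimodule.coboundary, LinearMap.coe_mk, AddHom.coe_mk,
    _root_.add_apply, _root_.smul_apply,
    _root_.sum_apply, contract_apply]
  rfl

/-- The image of the incoming coboundary operator in degree `n`. -/
def Bimodule.coboundaries (B : Bimodule A M) : (n : ℕ) → Submodule ℂ (Cochain A M n)
  | 0 => ⊥
  | n + 1 => LinearMap.range (B.coboundary n)

/-- The kernel of the outgoing coboundary operator in degree `n`. -/
def Bimodule.cocycles (B : Bimodule A M) (n : ℕ) : Submodule ℂ (Cochain A M n) :=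
  LinearMap.ker (B.coboundary n)

/-- The Hochschild cohomology group `Hⁿ(A, M) = ker δₙ / im δₙ₋₁`. -/
abbrev Bimodule.Cohomology (B : Bimodule A M) (n : ℕ) : Type (max u v) :=
  B.cocycles n ⧸ (B.coboundaries n).submoduleOf (B.cocycles n)

end Cochains

/-! ### Hochschild chains -/

section Chains

variable (A : Type u) [NormedRing A] [NormedAlgebra ℂ A]
variable (M : Type v) [NormedAddCommGroup M] [NormedSpace ℂ M]

/-- The continuous `n`-chains `M ⊗̂ A ⊗̂ ⋯ ⊗̂ A`. -/
abbrev Chain (n : ℕ) : Type (max u v) := ProjTensor M (ProjPower A n)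

/-- `x ↦ ((a₁, …, aₙ) ↦ x ⊗ a₁ ⊗ ⋯ ⊗ aₙ)`. -/
def chainMk (n : ℕ) : M →L[ℂ] (A [×n]→L[ℂ] Chain A M n) :=
  ((projMk M (ProjPower A n)).flip.compContinuousMultilinearMap (powMk A n)).flipLinear

variable {A M}

theorem chainMk_apply (n : ℕ) (x : M) (a : Fin n → A) :
    chainMk A M n x a = projMk M (ProjPower A n) x (powMk A n a) := rfl

variable {G : Type w} [NormedAddCommGroup G] [NormedSpace ℂ G] [CompleteSpace G]

/-- The bounded linear map on `n`-chains with prescribed values on elementary tensors. -/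
def chainLift {n : ℕ} (f : M →L[ℂ] (A [×n]→L[ℂ] G)) : Chain A M n →L[ℂ] G :=
  projLift (powLift.comp f)

@[simp]
theorem chainLift_mk {n : ℕ} (f : M →L[ℂ] (A [×n]→L[ℂ] G)) (x : M) (a : Fin n → A) :
    chainLift f (chainMk A M n x a) = f x a := by
  simp [chainLift, chainMk_apply]

/-- `x ↦ ((a₁, …, aₙ₊₁) ↦ (x · a₁) ⊗ a₂ ⊗ ⋯ ⊗ aₙ₊₁)`. -/
def Bimodule.firstFace (B : Bimodule A M) (n : ℕ) : M →L[ℂ] (A [×(n + 1)]→L[ℂ] Chain A M n) :=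
  ((continuousMultilinearCurryLeftEquiv ℂ (fun _ : Fin (n + 1) => A)
      (Chain A M n)).symm.toContinuousLinearEquiv.toContinuousLinearMap).comp
    ((ContinuousLinearMap.compL ℂ A M (A [×n]→L[ℂ] Chain A M n) (chainMk A M n)).comp
      B.right.flip)

/-- `x ↦ ((a₁, …, aₙ₊₁) ↦ (aₙ₊₁ · x) ⊗ a₁ ⊗ ⋯ ⊗ aₙ)`. -/
def Bimodule.lastFace (B : Bimodule A M) (n : ℕ) : M →L[ℂ] (A [×(n + 1)]→L[ℂ] Chain A M n) :=
  ((continuousMultilinearCurryRightEquiv ℂ (fun _ : Fin (n + 1) => A)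
      (Chain A M n)).symm.toContinuousLinearEquiv.toContinuousLinearMap).comp
    (((ContinuousLinearMap.flipMultilinearEquiv ℂ (fun _ : Fin n => A) A
        (Chain A M n)).toContinuousLinearMap).comp
      ((ContinuousLinearMap.compL ℂ A M (A [×n]→L[ℂ] Chain A M n) (chainMk A M n)).comp
        B.left.flip))

/-- The Hochschild boundary operator `dₙ`. -/
def Bimodule.boundary (B : Bimodule A M) (n : ℕ) : Chain A M (n + 1) →L[ℂ] Chain A M n :=
  chainLift (B.firstFace n
    + ∑ j : Fin n, (-1 : ℂ) ^ ((j : ℕ) + 1) • (contract j).comp (chainMk A M n)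
    + (-1 : ℂ) ^ (n + 1) • B.lastFace n)

theorem Bimodule.boundary_mk (B : Bimodule A M) (n : ℕ) (x : M) (a : Fin (n + 1) → A) :
    B.boundary n (chainMk A M (n + 1) x a) = chainMk A M n (B.right (a 0) x) (Fin.tail a)
      + ∑ j : Fin n, (-1 : ℂ) ^ ((j : ℕ) + 1) • chainMk A M n x (mulAt j a)
      + (-1 : ℂ) ^ (n + 1) • chainMk A M n (B.left (a (Fin.last n)) x) (Fin.init a) := by
  rw [Bimodule.boundary, chainLift_mk]
  simp only [_root_.add_apply, _root_.smul_apply,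
    _root_.sum_apply, _root_.add_apply,
    _root_.smul_apply, _root_.sum_apply,
    ContinuousLinearMap.comp_apply, contract_apply]
  rfl

/-- The kernel of the outgoing boundary operator in degree `n`. -/
def Bimodule.cycles (B : Bimodule A M) : (n : ℕ) → Submodule ℂ (Chain A M n)
  | 0 => ⊤
  | n + 1 => LinearMap.ker (B.boundary n).toLinearMap

/-- The image of the incoming boundary operator in degree `n`. -/
def Bimodule.boundaries (B : Bimodule A M) (n : ℕ) : Submodule ℂ (Chain A M n) :=
  LinearMap.range (B.boundary n).toLinearMap

/-- The Hochschild homology group `Hₙ(A, M) = ker dₙ₋₁ / im dₙ`. -/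
abbrev Bimodule.Homology (B : Bimodule A M) (n : ℕ) : Type (max u v) :=
  B.cycles n ⧸ (B.boundaries n).submoduleOf (B.cycles n)

/-- The left action `b · (x ⊗ a₁ ⊗ ⋯ ⊗ aₙ) = (b · x) ⊗ a₁ ⊗ ⋯ ⊗ aₙ` on chains. -/
def Bimodule.chainAct (B : Bimodule A M) (n : ℕ) (b : A) : Chain A M n →L[ℂ] Chain A M n :=
  chainLift ((chainMk A M n).comp (B.left b))

@[simp]
theorem Bimodule.chainAct_mk (B : Bimodule A M) (n : ℕ) (b : A) (x : M) (a : Fin n → A) :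
    B.chainAct n b (chainMk A M n x a) = chainMk A M n (B.left b x) a := by
  simp [Bimodule.chainAct]

end Chains

/-! ### Splitting of chain complexes -/

section Splitting

variable {X : ℕ → Type v} [∀ n, NormedAddCommGroup (X n)] [∀ n, NormedSpace ℂ (X n)]

/-- `s` is a contracting homotopy of the complex `0 ← X 0 ← X 1 ← X 2 ← ⋯` with differentials
`d n : X (n + 1) → X n`. -/
structure IsContractingHomotopy (d : ∀ n, X (n + 1) →L[ℂ] X n)
    (s : ∀ n, X n →L[ℂ] X (n + 1)) : Prop where
  zero : (d 0).comp (s 0) = ContinuousLinearMap.id ℂ (X 0)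
  succ : ∀ n, (s n).comp (d n) + (d (n + 1)).comp (s (n + 1))
    = ContinuousLinearMap.id ℂ (X (n + 1))

/-- The complex splits in the category of Banach spaces and bounded linear maps. -/
def SplitsAsBanachSpaces (d : ∀ n, X (n + 1) →L[ℂ] X n) : Prop :=
  ∃ s : ∀ n, X n →L[ℂ] X (n + 1), IsContractingHomotopy d s

/-- The complex splits in the category of left Banach `A`-modules and bounded `A`-module maps,
`act n a` being the action of `a` on `X n`. -/
def SplitsAsBanachModules {A : Type u} (act : ∀ n, A → X n →L[ℂ] X n)
    (d : ∀ n, X (n + 1) →L[ℂ] X n) : Prop :=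
  ∃ s : ∀ n, X n →L[ℂ] X (n + 1), IsContractingHomotopy d s ∧
    ∀ (n : ℕ) (a : A) (x : X n), s n (act n a x) = act (n + 1) a (s n x)

end Splitting

/-! ### Simplicial chains and cochains -/

section Simplicial

variable (A : Type u) [NormedRing A] [NormedAlgebra ℂ A]

/-- Simplicial homology `Hₙ(A, A)`. -/
abbrev SimplicialHomology (n : ℕ) : Type u := (Bimodule.regular A).Homology n

/-- Simplicial cohomology `Hⁿ(A, A')`. -/
abbrev SimplicialCohomology (n : ℕ) : Type u := (Bimodule.regular A).dual.Cohomology n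

/-- The differentials of `0 ← C₁(A, A) ← C₂(A, A) ← ⋯`; the term in position `n` is
`Cₙ₊₁(A, A)`. -/
def truncatedBoundary (n : ℕ) : Chain A A (n + 1 + 1) →L[ℂ] Chain A A (n + 1) :=
  (Bimodule.regular A).boundary (n + 1)

/-- The left `A`-module action `b · (a₀ ⊗ a₁ ⊗ ⋯) = b a₀ ⊗ a₁ ⊗ ⋯` on the terms of the truncated
complex. -/
def truncatedAct (n : ℕ) (b : A) : Chain A A (n + 1) →L[ℂ] Chain A A (n + 1) :=
  (Bimodule.regular A).chainAct (n + 1) b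

end Simplicial

end BanachHochschild

end

/-! The core is (b) ⇒ (d). The left module `C_n(A)` is free on the elements `1 ⊗ a₁ ⊗ ⋯ ⊗ aₙ`: a
bounded module map out of it is the same as a bounded `n`-linear map on `A`. Because `A` is an
`ℓ¹(Ω)`, bounded operators from `A` lift through surjections of Banach spaces, and by currying so do
bounded multilinear maps (`hasLifting_of_equiv_lp_one`, `HasLifting.multilinear`). Hence each
`C_n(A)` is projective as a module. Commutativity makes the boundaries `A`-linear and gives `d₀ =
0`, so under (b) the truncated complex is exact down to `C₁(A)`, and an exact complex of projectives
bounded below splits degree by degree (`exists_module_lift`, `splitsAsBanachModules_of_lifts`).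

An `A`-linear splitting survives `- ⊗_A M` and `Hom_A(-, M)`. For symmetric unit-linked `M` these
functors turn `C_n(A)` into `C_n(A, M)` and `Cⁿ(A, M)`, compatibly with the differentials
(`Bimodule.coeffAct`, `Bimodule.cochainExtend`), so (d) gives (e1) and (e2). Both specialise back,
to (a) and (b), since `A` and `A'` are symmetric and unit-linked; and (d) ⇒ (c) ⇒ (b) is immediate.

For (a) ⇒ (b), the cochains with values in `A'` form the dual of the chain complex. Vanishing in two
consecutive degrees makes the relevant transpose injective on the dual of the cycles, with closed
range, so the closed range theorem yields exactness of the chains (`subsingleton_homology_of_dual`).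
-/

noncomputable section

namespace BanachHochschild

universe u v w

/-! ### Surjectivity and exactness by duality -/

section Duality

variable {X : Type*} {Y : Type*} [NormedAddCommGroup X] [NormedSpace ℂ X]
  [NormedAddCommGroup Y] [NormedSpace ℂ Y]

/-- The successive approximation step of the open mapping theorem. -/
theorem surjective_of_approx_preimage [CompleteSpace X] (T : X →L[ℂ] Y) (C : ℝ)
    (h : ∀ y, ∃ x, ‖y - T x‖ ≤ 1 / 2 * ‖y‖ ∧ ‖x‖ ≤ C * ‖y‖) : Function.Surjective T := by
  choose g hg hgC using h
  intro y
  -- `r n` is the error left after `n` corrections; it halves each time, so the corrections `g (r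
  -- n)` sum to a preimage of `y`.
  set r : ℕ → Y := fun n => (fun z => z - T (g z))^[n] y with hr
  have hr_succ : ∀ n, r (n + 1) = r n - T (g (r n)) := fun n =>
    Function.iterate_succ_apply' _ n y
  have hr_norm : ∀ n, ‖r n‖ ≤ (1 / 2) ^ n * ‖y‖ := by
    intro n
    induction n with
    | zero => simp [hr]
    | succ n ih =>
      rw [hr_succ, pow_succ']
      have := hg (r n)
      linarith
  have hC : ∀ z : Y, C * ‖z‖ ≤ |C| * ‖z‖ := fun z =>
    mul_le_mul_of_nonneg_right (le_abs_self C) (norm_nonneg z)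
  have hsum : Summable fun n => g (r n) := by
    refine Summable.of_norm_bounded (g := fun n => (1 / 2 : ℝ) ^ n * (|C| * ‖y‖))
      (summable_geometric_two.mul_right _) fun n => ?_
    calc ‖g (r n)‖ ≤ |C| * ‖r n‖ := (hgC _).trans (hC _)
      _ ≤ |C| * ((1 / 2) ^ n * ‖y‖) := mul_le_mul_of_nonneg_left (hr_norm n) (abs_nonneg C)
      _ = _ := by ring
  refine ⟨∑' n, g (r n), ?_⟩
  have h₁ : Filter.Tendsto (fun n => T (∑ i ∈ Finset.range n, g (r i))) Filter.atTop
      (nhds (T (∑' n, g (r n)))) :=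
    (T.continuous.tendsto _).comp hsum.hasSum.tendsto_sum_nat
  have h₂ : ∀ n, T (∑ i ∈ Finset.range n, g (r i)) = y - r n := by
    intro n
    induction n with
    | zero => simp [hr]
    | succ n ih => rw [Finset.sum_range_succ, map_add, ih, hr_succ]; abel
  have h₃ : Filter.Tendsto r Filter.atTop (nhds 0) := by
    refine squeeze_zero_norm hr_norm ?_
    simpa using (tendsto_pow_atTop_nhds_zero_of_lt_one (r := (1 / 2 : ℝ))
      (by norm_num) (by norm_num)).mul_const ‖y‖
  simp only [h₂] at h₁
  exact tendsto_nhds_unique h₁ (by simpa using h₃.const_sub y)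

/-- An operator whose transpose is bounded below is onto. -/
theorem surjective_of_dual_bounded_below [CompleteSpace X] (T : X →L[ℂ] Y) {K : ℝ}
    (hK : 0 < K) (h : ∀ f : StrongDual ℂ Y, ‖f‖ ≤ K * ‖f.comp T‖) :
    Function.Surjective T := by
  refine surjective_of_approx_preimage T K fun y => ?_
  rcases eq_or_ne y 0 with rfl | hy
  · exact ⟨0, by simp⟩
  have hy' : 0 < ‖y‖ := norm_pos_iff.2 hy
  have hR : 0 < K * ‖y‖ := mul_pos hK hy'
  -- Approximation to within `‖y‖ / 2` by images from the ball of radius `K * ‖y‖` is exactly the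
  -- hypothesis of the approximation lemma with `C = K`.
  suffices hmem : y ∈ closure (T '' Metric.closedBall 0 (K * ‖y‖)) by
    obtain ⟨_, ⟨x, hx, rfl⟩, hxy⟩ := Metric.mem_closure_iff.1 hmem (1 / 2 * ‖y‖) (by positivity)
    exact ⟨x, by rw [← dist_eq_norm]; exact hxy.le, by simpa using hx⟩
  -- Otherwise Hahn–Banach separates `y` from the closed convex image of the ball, by a functional
  -- `f` at level `u`. Then `‖f.comp T‖ ≤ u / (K * ‖y‖)`, and the lower bound on the transpose
  -- forces `‖f y‖ ≤ u`, a contradiction.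
  by_contra hmem
  let _ : NormedSpace ℝ X := NormedSpace.restrictScalars ℝ ℂ X
  let _ : NormedSpace ℝ Y := NormedSpace.restrictScalars ℝ ℂ Y
  have hconv : Convex ℝ (closure (T '' Metric.closedBall 0 (K * ‖y‖))) :=
    Convex.closure ((convex_closedBall (0 : X) _).linear_image (T.toLinearMap.restrictScalars ℝ))
  obtain ⟨f, u, hfu, huy⟩ := RCLike.geometric_hahn_banach_closed_point (𝕜 := ℂ) hconv
    isClosed_closure hmem
  have hbound : ∀ x, ‖x‖ ≤ K * ‖y‖ → ‖f (T x)‖ ≤ u := by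
    intro x hx
    -- Separation controls only real parts; rotating `x` by a phase, which preserves the ball,
    -- upgrades this to a bound on the modulus.
    obtain ⟨c, hc, hcx⟩ : ∃ c : ℂ, ‖c‖ = 1 ∧ c * f (T x) = ‖f (T x)‖ := by
      obtain ⟨c, hc, h⟩ := RCLike.exists_norm_eq_mul_self (f (T x))
      exact ⟨c, hc, h.symm⟩
    have h1 := hfu (T (c • x)) (subset_closure ⟨c • x, by simp [norm_smul, hc, hx], rfl⟩)
    rw [map_smul, map_smul, smul_eq_mul, hcx] at h1
    simpa using h1.le
  have hnorm : ‖f.comp T‖ ≤ u / (K * ‖y‖) := by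
    have hu : 0 ≤ u := (norm_nonneg _).trans (hbound 0 (by simpa using hR.le))
    refine ContinuousLinearMap.opNorm_le_bound _ (by positivity) fun x => ?_
    rcases eq_or_ne x 0 with rfl | hx
    · simp
    have hx' : 0 < ‖x‖ := norm_pos_iff.2 hx
    have h1 := hbound (((K * ‖y‖ / ‖x‖ : ℝ) : ℂ) • x) (le_of_eq (by
      rw [norm_smul, Complex.norm_real, Real.norm_of_nonneg (by positivity)]
      field_simp))
    rw [map_smul, map_smul, norm_smul, Complex.norm_real, Real.norm_of_nonneg (by positivity),
      div_mul_eq_mul_div, div_le_iff₀ hx'] at h1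
    rw [div_mul_eq_mul_div, le_div_iff₀ hR, mul_comm]
    exact h1
  have h2 : u < u := calc
    u < RCLike.re (f y) := huy
    _ ≤ ‖f y‖ := RCLike.re_le_norm _
    _ ≤ ‖f‖ * ‖y‖ := f.le_opNorm y
    _ ≤ K * ‖f.comp T‖ * ‖y‖ := mul_le_mul_of_nonneg_right (h f) hy'.le
    _ ≤ K * (u / (K * ‖y‖)) * ‖y‖ := by gcongr
    _ = u := by field_simp
  exact lt_irrefl _ h2

variable {Z : Type*} [NormedAddCommGroup Z] [NormedSpace ℂ Z]

/-- An operator with injective transpose of closed range is onto. -/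
theorem surjective_of_dual_injective_of_isClosed_range [CompleteSpace X] (T : X →L[ℂ] Y)
    (hinj : ∀ f : StrongDual ℂ Y, f.comp T = 0 → f = 0)
    (hclosed : IsClosed (Set.range fun f : StrongDual ℂ Y => f.comp T)) :
    Function.Surjective T := by
  let D : StrongDual ℂ Y →L[ℂ] StrongDual ℂ X := (ContinuousLinearMap.compL ℂ X Y ℂ).flip T
  have hD : Function.Injective D := (injective_iff_map_eq_zero D).2 hinj
  obtain ⟨c, hanti⟩ := D.antilipschitz_of_injective_of_isClosed_range hD hclosed
  -- The antilipschitz constant `c` may be zero, whereas `K` must be positive; hence `c + 1`.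
  refine surjective_of_dual_bounded_below T (K := c + 1) (by positivity) fun f => ?_
  exact (D.bound_of_antilipschitz hanti f).trans
    (mul_le_mul_of_nonneg_right (by simp) (norm_nonneg (D f)))

/-- Exactness at `Y` of `X → Y → Z`, given exactness of the dual complex at `Y'` and closedness of
the range of `Y' → X'`. -/
theorem exists_preimage_of_dual_exact [CompleteSpace X] [CompleteSpace Y] (T : X →L[ℂ] Y)
    (S : Y →L[ℂ] Z) (hST : ∀ x, S (T x) = 0)
    (hexact : ∀ f : StrongDual ℂ Y, f.comp T = 0 → ∃ g : StrongDual ℂ Z, f = g.comp S)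
    (hclosed : IsClosed (Set.range fun f : StrongDual ℂ Y => f.comp T))
    (y : Y) (hy : S y = 0) : ∃ x, T x = y := by
  obtain ⟨K, hK⟩ : ∃ K : Submodule ℂ Y, K = S.ker := ⟨_, rfl⟩
  have hmem : ∀ k, k ∈ K ↔ S k = 0 := fun k => by rw [hK, LinearMap.mem_ker]; rfl
  let T₀ : X →L[ℂ] K := T.codRestrict K fun x => (hmem _).2 (hST x)
  have hT₀ : ∀ x, (T₀ x : Y) = T x := fun x => rfl
  have hinj : ∀ f : StrongDual ℂ K, f.comp T₀ = 0 → f = 0 := by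
    intro f hf
    obtain ⟨F, hF, -⟩ := exists_extension_norm_eq K f
    -- The extension `F` of `f` still kills the range of `T`, so by exactness it factors through `S`
    -- and therefore vanishes on `K = ker S`.
    obtain ⟨g, rfl⟩ := hexact F (by
      ext x
      exact (hF (T₀ x)).trans (DFunLike.congr_fun hf x))
    ext k
    rw [← hF k, ContinuousLinearMap.comp_apply, (hmem _).1 k.2, map_zero]
    rfl
  -- Functionals on `K` extend to `Y`, so passing to the kernel does not change the range of the
  -- transpose, which stays closed.
  have hrange : (Set.range fun f : StrongDual ℂ K => f.comp T₀)
      = Set.range fun f : StrongDual ℂ Y => f.comp T := by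
    ext φ
    constructor
    · rintro ⟨f, rfl⟩
      obtain ⟨F, hF, -⟩ := exists_extension_norm_eq K f
      exact ⟨F, by ext x; exact hF (T₀ x)⟩
    · rintro ⟨F, rfl⟩
      exact ⟨F.comp K.subtypeL, by ext x; rfl⟩
  have hKc : IsClosed (K : Set Y) := by
    have : (K : Set Y) = S ⁻¹' {0} := by ext k; exact hmem k
    rw [this]
    exact isClosed_singleton.preimage S.continuous
  have : CompleteSpace K := hKc.completeSpace_coe
  obtain ⟨x, hx⟩ := surjective_of_dual_injective_of_isClosed_range T₀ hinj (hrange ▸ hclosed)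
    ⟨y, (hmem _).2 hy⟩
  exact ⟨x, by rw [← hT₀, hx]⟩

end Duality

/-! ### Lifting through surjections -/

section Lifting

/-- A Banach space `E` has the lifting property if bounded operators from `E` lift through bounded
surjections of Banach spaces. -/
def HasLifting (E : Type u) [NormedAddCommGroup E] [NormedSpace ℂ E] : Prop :=
  ∀ (Z Y : Type u) [NormedAddCommGroup Z] [NormedSpace ℂ Z] [CompleteSpace Z]
    [NormedAddCommGroup Y] [NormedSpace ℂ Y] [CompleteSpace Y] (q : Z →L[ℂ] Y),
    Function.Surjective q → ∀ T : E →L[ℂ] Y, ∃ S : E →L[ℂ] Z, q.comp S = T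

/-- The operator on `ℓ¹(Ω)` with prescribed bounded values on the unit vectors. -/
theorem exists_lp_one_lift {Ω : Type w} [DecidableEq Ω] {Z : Type u} [NormedAddCommGroup Z]
    [NormedSpace ℂ Z] [CompleteSpace Z] (z : Ω → Z) (C : ℝ) (hz : ∀ ω, ‖z ω‖ ≤ C) :
    ∃ S : lp (fun _ : Ω => ℂ) 1 →L[ℂ] Z, ∀ ω c, S (lp.single 1 ω c) = c • z ω := by
  have hsumm : ∀ x : lp (fun _ : Ω => ℂ) 1, HasSum (fun ω => ‖x ω‖) ‖x‖ := fun x => by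
    simpa using lp.hasSum_norm (p := 1) (by simp) x
  have hb : ∀ (x : lp (fun _ : Ω => ℂ) 1) ω, ‖x ω • z ω‖ ≤ C * ‖x ω‖ := fun x ω => by
    rw [norm_smul, mul_comm]
    exact mul_le_mul_of_nonneg_right (hz ω) (norm_nonneg _)
  have hs : ∀ x : lp (fun _ : Ω => ℂ) 1, Summable fun ω => x ω • z ω := fun x =>
    Summable.of_norm_bounded ((hsumm x).summable.mul_left C) (hb x)
  refine ⟨LinearMap.mkContinuous
    { toFun := fun x => ∑' ω, x ω • z ω
      map_add' := fun x y => by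
        rw [← (hs x).tsum_add (hs y)]
        simp [add_smul]
      map_smul' := fun c x => by
        rw [RingHom.id_apply, ← (hs x).tsum_const_smul]
        simp [mul_smul] } C fun x => ?_, fun ω c => ?_⟩
  · exact tsum_of_norm_bounded ((hsumm x).mul_left C) (hb x)
  · simp only [LinearMap.mkContinuous_apply, LinearMap.coe_mk, AddHom.coe_mk]
    rw [tsum_eq_single ω fun ω' h => by rw [lp.single_apply_ne _ _ _ h, zero_smul],
      lp.single_apply_self]

/-- The unit vectors have norm one, so the open mapping theorem gives preimages of their images
under `T'` with a common bound. An operator on `ℓ¹(Ω)` may take any bounded family of values there,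
and it is determined by them. -/
theorem hasLifting_of_equiv_lp_one {E : Type u} [NormedAddCommGroup E] [NormedSpace ℂ E]
    {Ω : Type w} (e : E ≃L[ℂ] lp (fun _ : Ω => ℂ) 1) : HasLifting E := by
  classical
  intro Z Y _ _ _ _ _ _ q hq T
  obtain ⟨C, hC, hpre⟩ := q.exists_preimage_norm_le hq
  choose p hp hpC using hpre
  let T' : lp (fun _ : Ω => ℂ) 1 →L[ℂ] Y := T.comp e.symm.toContinuousLinearMap
  obtain ⟨S, hS⟩ := exists_lp_one_lift (fun ω => p (T' (lp.single 1 ω 1))) (C * ‖T'‖) fun ω => by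
    refine (hpC _).trans (mul_le_mul_of_nonneg_left ?_ hC.le)
    simpa [lp.norm_single] using T'.le_opNorm (lp.single 1 ω 1)
  have hqS : q.comp S = T' := by
    ext x
    have hx := lp.hasSum_single (p := 1) (by simp) x
    refine (hx.mapL (q.comp S)).unique ?_
    convert hx.mapL T' using 2 with ω
    rw [ContinuousLinearMap.comp_apply, hS, map_smul, hp, ← map_smul, ← lp.single_smul,
      smul_eq_mul, mul_one]
  refine ⟨S.comp e.toContinuousLinearMap, ?_⟩
  rw [← ContinuousLinearMap.comp_assoc, hqS]
  ext x
  simp [T']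

/-- Bounded multilinear maps on a space with the lifting property lift through surjections. -/
theorem HasLifting.multilinear {E : Type u} [NormedAddCommGroup E] [NormedSpace ℂ E]
    (hE : HasLifting E) {Z Y : Type u} [NormedAddCommGroup Z] [NormedSpace ℂ Z] [CompleteSpace Z]
    [NormedAddCommGroup Y] [NormedSpace ℂ Y] [CompleteSpace Y] (q : Z →L[ℂ] Y)
    (hq : Function.Surjective q) (n : ℕ) (T : E [×n]→L[ℂ] Y) :
    ∃ S : E [×n]→L[ℂ] Z, q.compContinuousMultilinearMap S = T := by
  induction n with
  | zero =>
    obtain ⟨z, hz⟩ := hq (T 0)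
    refine ⟨ContinuousMultilinearMap.uncurry0 ℂ E z, ?_⟩
    ext a
    rw [Subsingleton.elim a 0]
    simpa using hz
  | succ n ih =>
    -- The induction hypothesis says that composition with `q` is onto between the Banach spaces of
    -- `n`-linear maps; the lifting property is applied to that surjection and the curried map.
    obtain ⟨S, hS⟩ := hE (E [×n]→L[ℂ] Z) (E [×n]→L[ℂ] Y)
      (ContinuousLinearMap.compContinuousMultilinearMapL ℂ (fun _ : Fin n => E) Z Y q) ih
      T.curryLeft
    refine ⟨S.uncurryLeft, ?_⟩
    ext a
    have := congrArg (fun f => f (a 0) (Fin.tail a)) hS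
    simpa using this

end Lifting

/-! ### Bounded operators on chains -/

section ChainMaps

variable {A : Type u} [NormedRing A] [NormedAlgebra ℂ A]
variable {M : Type v} [NormedAddCommGroup M] [NormedSpace ℂ M]
variable {G : Type w} [NormedAddCommGroup G] [NormedSpace ℂ G]

theorem projTensor_hom_ext {E F : Type*} [NormedAddCommGroup E] [NormedSpace ℂ E]
    [NormedAddCommGroup F] [NormedSpace ℂ F] {f g : ProjTensor E F →L[ℂ] G}
    (h : ∀ x y, f (projMk E F x y) = g (projMk E F x y)) : f = g := by
  have key : ∀ z : AlgTensor E F, f (z : ProjTensor E F) = g (z : ProjTensor E F) := by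
    intro z
    obtain ⟨l, rfl⟩ := (inferInstance : Nonempty (AlgTensor.Rep z))
    induction l with
    | nil => rw [List.map_nil, List.sum_nil, UniformSpace.Completion.coe_zero, map_zero, map_zero]
    | cons p l ih =>
      rw [List.map_cons, List.sum_cons, UniformSpace.Completion.coe_add, map_add, map_add, ih]
      congr 1
      exact h p.1 p.2
  ext z
  induction z using UniformSpace.Completion.induction_on with
  | hp => exact isClosed_eq f.continuous g.continuous
  | ih z => exact key z

theorem projPower_hom_ext {E : Type*} [NormedAddCommGroup E] [NormedSpace ℂ E] {n : ℕ}
    {f g : ProjPower E n →L[ℂ] G} (h : ∀ a, f (powMk E n a) = g (powMk E n a)) : f = g := by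
  have key : (f.comp UniformSpace.Completion.toComplL).toLinearMap
      = (g.comp UniformSpace.Completion.toComplL).toLinearMap :=
    PiTensorProduct.ext (MultilinearMap.ext h)
  ext z
  induction z using UniformSpace.Completion.induction_on with
  | hp => exact isClosed_eq f.continuous g.continuous
  | ih z => exact LinearMap.congr_fun key z

/-- Elementary tensors span a dense subspace. Operator identities on chains are reduced to them
through this lemma. -/
theorem chain_hom_ext {n : ℕ} {f g : Chain A M n →L[ℂ] G}
    (h : ∀ x a, f (chainMk A M n x a) = g (chainMk A M n x a)) : f = g := by
  refine projTensor_hom_ext fun x y => ?_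
  have : f.comp (projMk M (ProjPower A n) x) = g.comp (projMk M (ProjPower A n) x) :=
    projPower_hom_ext (h x)
  exact DFunLike.congr_fun this y

variable {N : Type w} [NormedAddCommGroup N] [NormedSpace ℂ N]

/-- The map on chains induced by a bounded linear map of coefficients. -/
def chainMap (n : ℕ) (φ : M →L[ℂ] N) : Chain A M n →L[ℂ] Chain A N n :=
  chainLift ((chainMk A N n).comp φ)

@[simp]
theorem chainMap_mk (n : ℕ) (φ : M →L[ℂ] N) (x : M) (a : Fin n → A) :
    chainMap n φ (chainMk A M n x a) = chainMk A N n (φ x) a := by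
  simp [chainMap]

theorem boundary_chainMap (B : Bimodule A M) (B' : Bimodule A N) (φ : M →L[ℂ] N)
    (hl : ∀ a x, φ (B.left a x) = B'.left a (φ x))
    (hr : ∀ a x, φ (B.right a x) = B'.right a (φ x)) (n : ℕ) (c : Chain A M (n + 1)) :
    B'.boundary n (chainMap (n + 1) φ c) = chainMap n φ (B.boundary n c) := by
  have : (B'.boundary n).comp (chainMap (n + 1) φ) = (chainMap n φ).comp (B.boundary n) :=
    chain_hom_ext fun x a => by simp [Bimodule.boundary_mk, hl, hr]
  exact DFunLike.congr_fun this c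

end ChainMaps

/-! ### The boundary operators form a complex -/

section Complex

/-- Cancellation in a double alternating sum subject to the simplicial identity. -/
theorem sum_alternating_eq_zero {G : Type*} [AddCommGroup G] [Module ℂ G] (g : ℕ → ℕ → G) (n : ℕ)
    (h : ∀ i j, i ≤ j → j < n → g i (j + 1) = g j i) :
    ∑ j ∈ Finset.range (n + 1), ∑ i ∈ Finset.range n, (-1 : ℂ) ^ (i + j) • g i j = 0 := by
  induction n with
  | zero => simp
  | succ n ih =>
    have h₁ := ih fun i j hij hj => h i j hij (by omega)
    rw [Finset.sum_range_succ]
    -- The simplicial identity matches the new row `j = n + 1` with the new column `i = n`, with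
    -- opposite signs.
    have h₂ : ∀ i ∈ Finset.range (n + 1),
        (-1 : ℂ) ^ (i + (n + 1)) • g i (n + 1) = -((-1 : ℂ) ^ (n + i) • g n i) := fun i hi => by
      rw [h i n (by have := Finset.mem_range.1 hi; omega) (by omega), ← neg_smul]
      congr 1
      ring
    have h₃ : ∑ j ∈ Finset.range (n + 1), ∑ i ∈ Finset.range (n + 1), (-1 : ℂ) ^ (i + j) • g i j
        = ∑ j ∈ Finset.range (n + 1), (-1 : ℂ) ^ (n + j) • g n j := by
      rw [Finset.sum_congr rfl fun j _ => Finset.sum_range_succ _ n, Finset.sum_add_distrib, h₁,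
        zero_add]
    rw [Finset.sum_congr rfl h₂, Finset.sum_neg_distrib, h₃, add_neg_cancel]

/-- The entries `a₁, …, aₙ₊₁` after applying the `i`-th face map. -/
def faceTuple {A : Type u} [Mul A] {n : ℕ} (i : ℕ) (a : Fin (n + 1) → A) : Fin n → A := fun k =>
  if (k : ℕ) + 1 < i then a k.castSucc
  else if (k : ℕ) + 1 = i then a k.castSucc * a k.succ else a k.succ

theorem faceTuple_comm {A : Type u} [Semigroup A] {n : ℕ} {i j : ℕ} (hij : i ≤ j) (a : Fin (n + 2) → A) :
    faceTuple i (faceTuple (j + 1) a) = faceTuple j (faceTuple i a) := by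
  ext k
  simp only [faceTuple, Fin.val_castSucc, Fin.val_succ]
  split_ifs <;> first | omega | rfl | exact mul_assoc _ _ _ | exact (mul_assoc _ _ _).symm

variable {A : Type u} [NormedRing A] [NormedAlgebra ℂ A]
variable {M : Type v} [NormedAddCommGroup M] [NormedSpace ℂ M]

/-- The coefficient after applying the `i`-th face map. -/
def Bimodule.faceCoeff (B : Bimodule A M) {n : ℕ} (i : ℕ) (x : M) (a : Fin (n + 1) → A) : M :=
  if i = 0 then B.right (a 0) x else if i = n + 1 then B.left (a (Fin.last n)) x else x

/-- Indexing all `n + 2` faces uniformly by natural numbers reduces `d ∘ d = 0` to the simplicial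
identities for tuples and coefficients. -/
theorem Bimodule.boundary_mk_eq_sum (B : Bimodule A M) (n : ℕ) (x : M) (a : Fin (n + 1) → A) :
    B.boundary n (chainMk A M (n + 1) x a) = ∑ i ∈ Finset.range (n + 2),
      (-1 : ℂ) ^ i • chainMk A M n (B.faceCoeff i x a) (faceTuple i a) := by
  have h₀ : faceTuple 0 a = Fin.tail a := by ext k; simp [faceTuple, Fin.tail]
  have h₁ : faceTuple (n + 1) a = Fin.init a := by ext k; simp [faceTuple, Fin.init]
  have h₂ : ∀ j : Fin n, faceTuple (j + 1) a = mulAt j a := by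
    intro j
    ext k
    simp [faceTuple, mulAt, Fin.contractNth]
  rw [B.boundary_mk, Finset.sum_range_succ, Finset.sum_range_succ', Finset.sum_range]
  simp only [h₀, h₁, h₂]
  have h₃ : ∀ j : Fin n, ¬ ((j : ℕ) + 1 = n + 1) := fun j => by omega
  simp only [faceCoeff, h₃]
  simp
  abel

/-- The three bimodule axioms are the three corner cases: `i = j = 0`, `i = j = n + 1`, and `i = 0`,
`j = n + 1`. Elsewhere at most one action touches the coefficient. -/
theorem Bimodule.faceCoeff_comm (B : Bimodule A M) {n : ℕ} {i j : ℕ} (hij : i ≤ j)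
    (hj : j < n + 2) (x : M) (a : Fin (n + 2) → A) :
    B.faceCoeff i (B.faceCoeff (j + 1) x a) (faceTuple (j + 1) a)
      = B.faceCoeff j (B.faceCoeff i x a) (faceTuple i a) := by
  rcases Nat.eq_zero_or_pos i with rfl | hi
  · rcases Nat.eq_zero_or_pos j with rfl | hj₀
    · simp [faceCoeff, faceTuple, B.right_mul]
    · rcases eq_or_ne j (n + 1) with rfl | hj₁
      · simp [faceCoeff, faceTuple, B.left_right]
      · simp [faceCoeff, faceTuple, hj₀, hj₀.ne', hj₁]
  · rcases eq_or_ne j (n + 1) with rfl | hj₁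
    · rcases eq_or_ne i (n + 1) with rfl | hi₁
      · simp [faceCoeff, faceTuple, B.left_mul]
      · have h₁ : ¬ n + 1 < i := by omega
        have h₂ : i ≠ n + 1 + 1 := by omega
        simp [faceCoeff, faceTuple, hi.ne', hi₁, hi₁.symm, h₁, h₂]
    · have h₁ : i ≠ n + 1 := by omega
      have h₂ : j ≠ 0 := by omega
      have h₃ : i ≠ n + 2 := by omega
      simp [faceCoeff, hi.ne', hj₁, h₁, h₂, h₃]

theorem Bimodule.boundary_boundary (B : Bimodule A M) (n : ℕ) (c : Chain A M (n + 2)) :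
    B.boundary n (B.boundary (n + 1) c) = 0 := by
  have : (B.boundary n).comp (B.boundary (n + 1)) = 0 := by
    refine chain_hom_ext fun x a => ?_
    rw [ContinuousLinearMap.comp_apply, B.boundary_mk_eq_sum, map_sum]
    simp only [map_smul, B.boundary_mk_eq_sum, Finset.smul_sum, smul_smul, ← pow_add]
    refine Eq.trans ?_ (sum_alternating_eq_zero (fun i j => chainMk A M n
      (B.faceCoeff i (B.faceCoeff j x a) (faceTuple j a)) (faceTuple i (faceTuple j a))) (n + 2)
      fun i j hij hj => ?_)
    · exact Finset.sum_congr rfl fun j _ => Finset.sum_congr rfl fun i _ => by rw [add_comm]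
    · rw [B.faceCoeff_comm hij hj, faceTuple_comm hij]
  exact DFunLike.congr_fun this c

end Complex

/-! ### Vanishing of homology and cohomology -/

section Vanishing

variable {A : Type u} [NormedRing A] [NormedAlgebra ℂ A]
variable {M : Type v} [NormedAddCommGroup M] [NormedSpace ℂ M]

theorem Bimodule.subsingleton_homology_succ_iff (B : Bimodule A M) (n : ℕ) :
    Subsingleton (B.Homology (n + 1)) ↔
      ∀ c, B.boundary n c = 0 → ∃ b, B.boundary (n + 1) b = c := by
  rw [Submodule.Quotient.subsingleton_iff, Submodule.submoduleOf,
    Submodule.comap_subtype_eq_top]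
  rfl

theorem Bimodule.subsingleton_cohomology_succ_iff (B : Bimodule A M) (n : ℕ) :
    Subsingleton (B.Cohomology (n + 1)) ↔
      ∀ F, B.coboundary (n + 1) F = 0 → ∃ G, B.coboundary n G = F := by
  rw [Submodule.Quotient.subsingleton_iff, Submodule.submoduleOf,
    Submodule.comap_subtype_eq_top]
  rfl

theorem forall_one_le_iff {p : ℕ → Prop} : (∀ n, 1 ≤ n → p n) ↔ ∀ n, p (n + 1) :=
  ⟨fun h n => h _ (Nat.succ_pos n), fun h n hn => by
    obtain ⟨m, rfl⟩ := Nat.exists_eq_add_of_le' hn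
    exact h m⟩

end Vanishing

/-! ### Cochains with values in a dual module as functionals on chains -/

section DualCochains

variable {A : Type u} [NormedRing A] [NormedAlgebra ℂ A]
variable {M : Type v} [NormedAddCommGroup M] [NormedSpace ℂ M]

/-- The functional `x ⊗ a₁ ⊗ ⋯ ⊗ aₙ ↦ F(a₁, …, aₙ)(x)`. -/
def chainFunctional {n : ℕ} (F : Cochain A (StrongDual ℂ M) n) : StrongDual ℂ (Chain A M n) :=
  chainLift F.flipLinear

@[simp]
theorem chainFunctional_mk {n : ℕ} (F : Cochain A (StrongDual ℂ M) n) (x : M) (a : Fin n → A) :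
    chainFunctional F (chainMk A M n x a) = F a x := by
  simp [chainFunctional]

/-- The cochain `(a₁, …, aₙ) ↦ (x ↦ φ(x ⊗ a₁ ⊗ ⋯ ⊗ aₙ))`. -/
def cochainOfFunctional {n : ℕ} (φ : StrongDual ℂ (Chain A M n)) :
    Cochain A (StrongDual ℂ M) n :=
  ((ContinuousLinearMap.compContinuousMultilinearMapL ℂ (fun _ : Fin n => A) (Chain A M n) ℂ
    φ).comp (chainMk A M n)).flipMultilinear

@[simp]
theorem cochainOfFunctional_apply {n : ℕ} (φ : StrongDual ℂ (Chain A M n)) (x : M)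
    (a : Fin n → A) : cochainOfFunctional φ a x = φ (chainMk A M n x a) := rfl

@[simp]
theorem chainFunctional_cochainOfFunctional {n : ℕ} (φ : StrongDual ℂ (Chain A M n)) :
    chainFunctional (cochainOfFunctional φ) = φ :=
  chain_hom_ext fun x a => by simp

/-- Under `Cⁿ(A, M') = C_n(A, M)'` the coboundary is the transpose of the boundary: the dual actions
swap sides, so `a₁ · F(…)` evaluated at `x` is `F(…)` at `x · a₁`. -/
theorem chainFunctional_coboundary (B : Bimodule A M) {n : ℕ} (F : Cochain A (StrongDual ℂ M) n) :
    chainFunctional (B.dual.coboundary n F) = (chainFunctional F).comp (B.boundary n) :=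
  chain_hom_ext fun x a => by
    simp [B.boundary_mk, B.dual.coboundary_apply]

theorem exists_comp_boundary_eq (B : Bimodule A M) (n : ℕ)
    (h : Subsingleton (B.dual.Cohomology (n + 1))) (φ : StrongDual ℂ (Chain A M (n + 1)))
    (hφ : φ.comp (B.boundary (n + 1)) = 0) : ∃ ψ, φ = ContinuousLinearMap.comp ψ (B.boundary n) := by
  obtain ⟨G, hG⟩ := (B.dual.subsingleton_cohomology_succ_iff n).1 h (cochainOfFunctional φ) (by
    ext a x
    rw [← chainFunctional_mk, chainFunctional_coboundary, chainFunctional_cochainOfFunctional, hφ]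
    rfl)
  exact ⟨chainFunctional G, by
    rw [← chainFunctional_coboundary, hG, chainFunctional_cochainOfFunctional]⟩

/-- If the cohomology with coefficients in the dual bimodule vanishes in degrees `n + 1` and
`n + 2`, then the homology vanishes in degree `n + 1`. -/
theorem subsingleton_homology_of_dual (B : Bimodule A M) (n : ℕ)
    (h₁ : Subsingleton (B.dual.Cohomology (n + 1)))
    (h₂ : Subsingleton (B.dual.Cohomology (n + 1 + 1))) : Subsingleton (B.Homology (n + 1)) := by
  rw [B.subsingleton_homology_succ_iff]
  have hclosed : IsClosed (Set.range fun f : StrongDual ℂ (Chain A M (n + 1)) =>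
      f.comp (B.boundary (n + 1))) := by
    -- Vanishing one degree higher identifies this range with the annihilator of the boundaries, an
    -- intersection of closed hyperplanes or whole spaces.
    have hrange : (Set.range fun f : StrongDual ℂ (Chain A M (n + 1)) =>
        f.comp (B.boundary (n + 1))) = ⋂ c, {φ | φ (B.boundary (n + 2) c) = 0} := by
      ext φ
      rw [Set.mem_iInter]
      constructor
      · rintro ⟨f, rfl⟩ c
        change f (B.boundary (n + 1) (B.boundary (n + 2) c)) = 0
        rw [B.boundary_boundary, map_zero]
      · intro hφ
        obtain ⟨ψ, hψ⟩ := exists_comp_boundary_eq B (n + 1) h₂ φ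
          (ContinuousLinearMap.ext hφ)
        exact ⟨ψ, hψ.symm⟩
    rw [hrange]
    exact isClosed_iInter fun c => isClosed_eq (by fun_prop) continuous_const
  exact exists_preimage_of_dual_exact (B.boundary (n + 1)) (B.boundary n)
    (B.boundary_boundary n) (exists_comp_boundary_eq B n h₁) hclosed

end DualCochains

/-! ### Transport of bimodules along isomorphisms -/

section Transport

variable {A : Type u} [NormedRing A] [NormedAlgebra ℂ A]
variable {M : Type v} [NormedAddCommGroup M] [NormedSpace ℂ M]
variable {N : Type w} [NormedAddCommGroup N] [NormedSpace ℂ N]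

/-- Transport of a bimodule structure along a linear homeomorphism. -/
def Bimodule.transport (B : Bimodule A M) (φ : N ≃L[ℂ] M) : Bimodule A N where
  left := ((ContinuousLinearMap.compL ℂ N M N φ.symm.toContinuousLinearMap).comp
    ((ContinuousLinearMap.compL ℂ N M M).flip φ.toContinuousLinearMap)).comp B.left
  right := ((ContinuousLinearMap.compL ℂ N M N φ.symm.toContinuousLinearMap).comp
    ((ContinuousLinearMap.compL ℂ N M M).flip φ.toContinuousLinearMap)).comp B.right
  left_mul a b x := by simp [B.left_mul]
  right_mul a b x := by simp [B.right_mul]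
  left_right a b x := by simp [B.left_right]

variable (B : Bimodule A M) (φ : N ≃L[ℂ] M)

@[simp]
theorem Bimodule.transport_left (a : A) (x : N) :
    (B.transport φ).left a x = φ.symm (B.left a (φ x)) := rfl

@[simp]
theorem Bimodule.transport_right (a : A) (x : N) :
    (B.transport φ).right a x = φ.symm (B.right a (φ x)) := rfl

variable {B}

theorem Bimodule.IsSymmetric.transport (h : B.IsSymmetric) : (B.transport φ).IsSymmetric :=
  fun a x => by simp [h a]

theorem Bimodule.IsUnitLinked.transport (h : B.IsUnitLinked) : (B.transport φ).IsUnitLinked :=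
  fun x => by simp [(h (φ x)).1, (h (φ x)).2]

variable (B)

theorem Bimodule.subsingleton_homology_of_transport (n : ℕ)
    (h : Subsingleton ((B.transport φ).Homology (n + 1))) : Subsingleton (B.Homology (n + 1)) := by
  rw [Bimodule.subsingleton_homology_succ_iff] at h ⊢
  intro c hc
  have hsymm := boundary_chainMap B (B.transport φ) φ.symm.toContinuousLinearMap
    (by simp) (by simp)
  have hφ := boundary_chainMap (B.transport φ) B φ.toContinuousLinearMap
    (by simp) (by simp)
  obtain ⟨b, hb⟩ := h (chainMap (n + 1) φ.symm.toContinuousLinearMap c)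
    (by rw [hsymm, hc, map_zero])
  refine ⟨chainMap (n + 2) φ.toContinuousLinearMap b, ?_⟩
  rw [hφ, hb]
  have : (chainMap (n + 1) φ.toContinuousLinearMap).comp
      (chainMap (n + 1) φ.symm.toContinuousLinearMap)
      = ContinuousLinearMap.id ℂ (Chain A M (n + 1)) := chain_hom_ext fun x a => by simp
  exact DFunLike.congr_fun this c

theorem Bimodule.subsingleton_cohomology_of_transport (n : ℕ)
    (h : Subsingleton ((B.transport φ).Cohomology (n + 1))) :
    Subsingleton (B.Cohomology (n + 1)) := by
  rw [Bimodule.subsingleton_cohomology_succ_iff] at h ⊢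
  have hsymm : ∀ (m : ℕ) (F : Cochain A M m), (B.transport φ).coboundary m
      (φ.symm.toContinuousLinearMap.compContinuousMultilinearMap F)
      = φ.symm.toContinuousLinearMap.compContinuousMultilinearMap (B.coboundary m F) := by
    intro m F
    ext a
    simp [Bimodule.coboundary_apply]
  have hφ : ∀ (m : ℕ) (F : Cochain A N m), B.coboundary m
      (φ.toContinuousLinearMap.compContinuousMultilinearMap F)
      = φ.toContinuousLinearMap.compContinuousMultilinearMap
        ((B.transport φ).coboundary m F) := by
    intro m F
    ext a
    simp [Bimodule.coboundary_apply]
  intro F hF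
  obtain ⟨G, hG⟩ := h (φ.symm.toContinuousLinearMap.compContinuousMultilinearMap F)
    (by rw [hsymm, hF]; ext a; simp)
  refine ⟨φ.toContinuousLinearMap.compContinuousMultilinearMap G, ?_⟩
  rw [hφ, hG]
  ext a
  simp

end Transport

/-! ### Symmetric bimodules over commutative algebras -/

section Commutative

variable {A : Type u} [NormedCommRing A] [NormedAlgebra ℂ A]
variable {M : Type v} [NormedAddCommGroup M] [NormedSpace ℂ M]

theorem Bimodule.regular_left_apply (a b : A) : (Bimodule.regular A).left a b = a * b := rfl

theorem Bimodule.regular_right_apply (a b : A) : (Bimodule.regular A).right a b = b * a := rfl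

theorem Bimodule.regular_isSymmetric : (Bimodule.regular A).IsSymmetric := fun a b =>
  mul_comm a b

theorem Bimodule.regular_isUnitLinked : (Bimodule.regular A).IsUnitLinked := fun a =>
  ⟨one_mul a, mul_one a⟩

theorem Bimodule.IsSymmetric.dual {B : Bimodule A M} (h : B.IsSymmetric) : B.dual.IsSymmetric :=
  fun a φ => by ext x; simp [h a]

theorem Bimodule.IsUnitLinked.dual {B : Bimodule A M} (h : B.IsUnitLinked) :
    B.dual.IsUnitLinked :=
  fun φ => ⟨by ext x; simp [(h x).2], by ext x; simp [(h x).1]⟩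

/-- Here `d₀(x ⊗ a) = x · a - a · x`. Hence every 1-chain is a cycle, which is why the complex can
be truncated at degree one. -/
theorem Bimodule.IsSymmetric.boundary_zero {B : Bimodule A M} (h : B.IsSymmetric) :
    B.boundary 0 = 0 :=
  chain_hom_ext fun x a => by
    rw [B.boundary_mk, ← h]
    have : Fin.tail a = Fin.init a := Subsingleton.elim _ _
    simp [this]

/-- The map `(a₀ ⊗ a₁ ⊗ ⋯ ⊗ aₙ, x) ↦ a₀ x ⊗ a₁ ⊗ ⋯ ⊗ aₙ`. -/
def Bimodule.coeffAct (B : Bimodule A M) (n : ℕ) : Chain A A n →L[ℂ] M →L[ℂ] Chain A M n :=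
  chainLift (((ContinuousLinearMap.flipMultilinearEquiv ℂ (fun _ : Fin n => A) M
    (Chain A M n)).toContinuousLinearMap).comp
      ((ContinuousLinearMap.compL ℂ M M (A [×n]→L[ℂ] Chain A M n) (chainMk A M n)).comp B.left))

@[simp]
theorem Bimodule.coeffAct_mk (B : Bimodule A M) (n : ℕ) (a₀ : A) (a : Fin n → A) (x : M) :
    B.coeffAct n (chainMk A A n a₀ a) x = chainMk A M n (B.left a₀ x) a := by
  rw [coeffAct, chainLift_mk]
  rfl

/-- Symmetry turns the right action in the first face into a left one; commutativity then lets `x`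
pass through every face. -/
theorem Bimodule.boundary_coeffAct {B : Bimodule A M} (h : B.IsSymmetric) (n : ℕ)
    (c : Chain A A (n + 1)) (x : M) :
    B.boundary n (B.coeffAct (n + 1) c x) = B.coeffAct n ((Bimodule.regular A).boundary n c) x := by
  have : (B.boundary n).comp ((B.coeffAct (n + 1)).flip x)
      = ((B.coeffAct n).flip x).comp ((Bimodule.regular A).boundary n) :=
    chain_hom_ext fun a₀ a => by
      simp [Bimodule.boundary_mk, ← h _ (B.left _ _), ← B.left_mul,
        Bimodule.regular_left_apply, Bimodule.regular_right_apply, mul_comm]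
  exact DFunLike.congr_fun this c

/-- The pairing is `A`-balanced, as for the quotient map onto `C_n(A) ⊗_A M`. -/
theorem Bimodule.coeffAct_chainAct (B : Bimodule A M) (n : ℕ) (b : A) (c : Chain A A n) (x : M) :
    B.coeffAct n ((Bimodule.regular A).chainAct n b c) x = B.coeffAct n c (B.left b x) := by
  have : ((B.coeffAct n).flip x).comp ((Bimodule.regular A).chainAct n b)
      = (B.coeffAct n).flip (B.left b x) :=
    chain_hom_ext fun a₀ a => by
      simp [← B.left_mul, Bimodule.regular_left_apply, mul_comm]
  exact DFunLike.congr_fun this c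

theorem regular_coeffAct (n : ℕ) (c : Chain A A n) (b : A) :
    (Bimodule.regular A).coeffAct n c b = (Bimodule.regular A).chainAct n b c := by
  have : ((Bimodule.regular A).coeffAct n).flip b = (Bimodule.regular A).chainAct n b :=
    chain_hom_ext fun a₀ a => by simp [Bimodule.regular_left_apply, mul_comm]
  exact DFunLike.congr_fun this c

theorem regular_boundary_chainAct (n : ℕ) (b : A) (c : Chain A A (n + 1)) :
    (Bimodule.regular A).boundary n ((Bimodule.regular A).chainAct (n + 1) b c)
      = (Bimodule.regular A).chainAct n b ((Bimodule.regular A).boundary n c) := by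
  rw [← regular_coeffAct, Bimodule.boundary_coeffAct Bimodule.regular_isSymmetric,
    regular_coeffAct]

theorem regular_chainAct_mul (n : ℕ) (a b : A) (c : Chain A A n) :
    (Bimodule.regular A).chainAct n (a * b) c
      = (Bimodule.regular A).chainAct n a ((Bimodule.regular A).chainAct n b c) := by
  rw [← regular_coeffAct _ _ a, Bimodule.coeffAct_chainAct, regular_coeffAct,
    Bimodule.regular_left_apply, mul_comm]

theorem chainMk_eq_chainAct (n : ℕ) (b : A) (a : Fin n → A) :
    chainMk A A n b a = (Bimodule.regular A).chainAct n b (chainMk A A n 1 a) := by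
  simp [Bimodule.regular_left_apply]

/-- The map `x ⊗ a₁ ⊗ ⋯ ⊗ aₘ ↦ x · g(a₁, …, aₘ)` induced by a multilinear map `g` with values in
the `k`-chains of `A`. -/
def Bimodule.extend (B : Bimodule A M) {m k : ℕ} (g : A [×m]→L[ℂ] Chain A A k) :
    Chain A M m →L[ℂ] Chain A M k :=
  chainLift (((B.coeffAct k).compContinuousMultilinearMap g).flipLinear)

@[simp]
theorem Bimodule.extend_mk (B : Bimodule A M) {m k : ℕ} (g : A [×m]→L[ℂ] Chain A A k) (x : M)
    (a : Fin m → A) : B.extend g (chainMk A M m x a) = B.coeffAct k (g a) x := by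
  simp [Bimodule.extend]

theorem regular_extend_chainAct {m k : ℕ} (g : A [×m]→L[ℂ] Chain A A k) (b : A)
    (c : Chain A A m) : (Bimodule.regular A).extend g ((Bimodule.regular A).chainAct m b c)
      = (Bimodule.regular A).chainAct k b ((Bimodule.regular A).extend g c) := by
  have : ((Bimodule.regular A).extend g).comp ((Bimodule.regular A).chainAct m b)
      = ((Bimodule.regular A).chainAct k b).comp ((Bimodule.regular A).extend g) :=
    chain_hom_ext fun a₀ a => by
      simp [regular_coeffAct, Bimodule.regular_left_apply, regular_chainAct_mul]
  exact DFunLike.congr_fun this c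

/-- Module maps on chains with coefficients in `A` extend to chains with coefficients in `M`. -/
theorem Bimodule.extend_coeffAct (B : Bimodule A M) {m k : ℕ} (s : Chain A A m →L[ℂ] Chain A A k)
    (hs : ∀ a c, s ((Bimodule.regular A).chainAct m a c) = (Bimodule.regular A).chainAct k a (s c))
    (c : Chain A A m) (x : M) :
    B.extend (s.compContinuousMultilinearMap (chainMk A A m 1)) (B.coeffAct m c x)
      = B.coeffAct k (s c) x := by
  have : (B.extend (s.compContinuousMultilinearMap (chainMk A A m 1))).comp
      ((B.coeffAct m).flip x) = ((B.coeffAct k).flip x).comp s :=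
    chain_hom_ext fun a₀ a => by
      have h := hs a₀ (chainMk A A m 1 a)
      rw [← chainMk_eq_chainAct] at h
      simp [h, B.coeffAct_chainAct]
  exact DFunLike.congr_fun this c

/-- The map `a₀ ⊗ a₁ ⊗ ⋯ ⊗ aₙ ↦ a₀ · F(a₁, …, aₙ)`. -/
def Bimodule.cochainExtend [CompleteSpace M] (B : Bimodule A M) {n : ℕ} (F : Cochain A M n) :
    Chain A A n →L[ℂ] M :=
  chainLift ((B.left.flip.compContinuousMultilinearMap F).flipLinear)

@[simp]
theorem Bimodule.cochainExtend_mk [CompleteSpace M] (B : Bimodule A M) {n : ℕ}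
    (F : Cochain A M n) (a₀ : A) (a : Fin n → A) :
    B.cochainExtend F (chainMk A A n a₀ a) = B.left a₀ (F a) := by
  simp [Bimodule.cochainExtend]

theorem Bimodule.cochainExtend_chainAct [CompleteSpace M] (B : Bimodule A M) {n : ℕ}
    (F : Cochain A M n) (b : A) (c : Chain A A n) :
    B.cochainExtend F ((Bimodule.regular A).chainAct n b c) = B.left b (B.cochainExtend F c) := by
  have : (B.cochainExtend F).comp ((Bimodule.regular A).chainAct n b)
      = (B.left b).comp (B.cochainExtend F) :=
    chain_hom_ext fun a₀ a => by simp [Bimodule.regular_left_apply, B.left_mul]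
  exact DFunLike.congr_fun this c

/-- This is `Cⁿ(A, M) = Hom_A(C_n(A), M)` as complexes; symmetry is needed for the last term, where
`aₙ₊₁` moves to the left. -/
theorem Bimodule.cochainExtend_boundary [CompleteSpace M] {B : Bimodule A M} (h : B.IsSymmetric)
    {n : ℕ} (F : Cochain A M n) (c : Chain A A (n + 1)) :
    B.cochainExtend F ((Bimodule.regular A).boundary n c)
      = B.cochainExtend (B.coboundary n F) c := by
  have : (B.cochainExtend F).comp ((Bimodule.regular A).boundary n)
      = B.cochainExtend (B.coboundary n F) :=
    chain_hom_ext fun a₀ a => by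
      rw [ContinuousLinearMap.comp_apply, Bimodule.boundary_mk, cochainExtend_mk,
        coboundary_apply, ← h, Bimodule.regular_left_apply, Bimodule.regular_right_apply,
        mul_comm (a (Fin.last n))]
      simp [B.left_mul]
  exact DFunLike.congr_fun this c

end Commutative

/-! ### Consequences of a splitting -/

section Splitting

section

variable {X : ℕ → Type v} [∀ n, NormedAddCommGroup (X n)] [∀ n, NormedSpace ℂ (X n)]
  {d : ∀ n, X (n + 1) →L[ℂ] X n} {s : ∀ n, X n →L[ℂ] X (n + 1)}

theorem IsContractingHomotopy.apply_zero (h : IsContractingHomotopy d s) (x : X 0) :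
    d 0 (s 0 x) = x := DFunLike.congr_fun h.zero x

theorem IsContractingHomotopy.apply_succ (h : IsContractingHomotopy d s) (n : ℕ)
    (x : X (n + 1)) : s n (d n x) + d (n + 1) (s (n + 1) x) = x :=
  DFunLike.congr_fun (h.succ n) x

end

variable {A : Type u} [NormedCommRing A] [NormedAlgebra ℂ A]

/-- A contracting homotopy of the truncated complex, in terms of the boundary operators. -/
theorem exists_homotopy_of_splits
    (h : SplitsAsBanachSpaces (X := fun n => Chain A A (n + 1)) (truncatedBoundary A)) :
    ∃ s : ∀ n, Chain A A (n + 1) →L[ℂ] Chain A A (n + 1 + 1),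
      (∀ c, (Bimodule.regular A).boundary (0 + 1) (s 0 c) = c) ∧
      ∀ n c, s n ((Bimodule.regular A).boundary (n + 1) c)
        + (Bimodule.regular A).boundary (n + 1 + 1) (s (n + 1) c) = c := by
  obtain ⟨s, hs⟩ := h
  exact ⟨s, hs.apply_zero, hs.apply_succ⟩

/-- A contracting homotopy of the truncated complex of modules, in terms of the boundary
operators. -/
theorem exists_module_homotopy_of_splits
    (h : SplitsAsBanachModules (X := fun n => Chain A A (n + 1)) (truncatedAct A)
      (truncatedBoundary A)) :
    ∃ s : ∀ n, Chain A A (n + 1) →L[ℂ] Chain A A (n + 1 + 1),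
      (∀ c, (Bimodule.regular A).boundary (0 + 1) (s 0 c) = c) ∧
      (∀ n c, s n ((Bimodule.regular A).boundary (n + 1) c)
        + (Bimodule.regular A).boundary (n + 1 + 1) (s (n + 1) c) = c) ∧
      ∀ n a c, s n ((Bimodule.regular A).chainAct (n + 1) a c)
        = (Bimodule.regular A).chainAct (n + 1 + 1) a (s n c) := by
  obtain ⟨s, hs, hact⟩ := h
  exact ⟨s, hs.apply_zero, hs.apply_succ, hact⟩

theorem subsingleton_homology_of_splits
    (h : SplitsAsBanachSpaces (X := fun n => Chain A A (n + 1)) (truncatedBoundary A)) (n : ℕ) :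
    Subsingleton (SimplicialHomology A (n + 1)) := by
  obtain ⟨s, hs₀, hs⟩ := exists_homotopy_of_splits h
  rw [Bimodule.subsingleton_homology_succ_iff]
  intro c hc
  cases n with
  | zero => exact ⟨s 0 c, hs₀ c⟩
  | succ n =>
    refine ⟨s (n + 1) c, ?_⟩
    have h₁ := hs n c
    rw [hc, map_zero, zero_add] at h₁
    exact h₁

variable {M : Type v} [NormedAddCommGroup M] [NormedSpace ℂ M]

-- The operators `s ⊗_A id_M` contract the complex with coefficients in `M`. Unit-linkedness writes
-- every elementary tensor as `(1 ⊗ a) · x`, so the homotopy identity for `A` transfers.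
set_option maxHeartbeats 1000000 in
theorem Bimodule.subsingleton_homology_of_splits {B : Bimodule A M} (hB : B.IsSymmetric)
    (hB₁ : B.IsUnitLinked)
    (h : SplitsAsBanachModules (X := fun n => Chain A A (n + 1)) (truncatedAct A)
      (truncatedBoundary A)) (n : ℕ) :
    Subsingleton (B.Homology (n + 1)) := by
  obtain ⟨s, hs₀, hs, hact⟩ := exists_module_homotopy_of_splits h
  rw [Bimodule.subsingleton_homology_succ_iff]
  have hmk : ∀ (m : ℕ) (x : M) (a : Fin m → A),
      chainMk A M m x a = B.coeffAct m (chainMk A A m 1 a) x := fun m x a => by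
    rw [B.coeffAct_mk, (hB₁ x).1]
  obtain ⟨t, ht⟩ : ∃ t : ∀ m, Chain A M (m + 1) →L[ℂ] Chain A M (m + 1 + 1),
      ∀ m c x, t m (B.coeffAct (m + 1) c x) = B.coeffAct (m + 1 + 1) (s m c) x :=
    ⟨_, fun m => B.extend_coeffAct (s m) (hact m)⟩
  intro c hc
  cases n with
  | zero =>
    have key : (B.boundary (0 + 1)).comp (t 0) = ContinuousLinearMap.id ℂ (Chain A M (0 + 1)) :=
      chain_hom_ext fun x a => by
        rw [ContinuousLinearMap.comp_apply, hmk, ht, boundary_coeffAct hB, hs₀,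
          ContinuousLinearMap.id_apply]
    exact ⟨t 0 c, DFunLike.congr_fun key c⟩
  | succ n =>
    have hcoeff : ∀ c₀ x, t n (B.boundary (n + 1) (B.coeffAct (n + 1 + 1) c₀ x))
        + B.boundary (n + 1 + 1) (t (n + 1) (B.coeffAct (n + 1 + 1) c₀ x))
        = B.coeffAct (n + 1 + 1) c₀ x := fun c₀ x => by
      have h₁ : t n (B.boundary (n + 1) (B.coeffAct (n + 1 + 1) c₀ x))
          = B.coeffAct (n + 1 + 1) (s n ((Bimodule.regular A).boundary (n + 1) c₀)) x :=
        (congrArg (t n) (boundary_coeffAct hB (n + 1) c₀ x)).trans (ht n _ x)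
      have h₂ : B.boundary (n + 1 + 1) (t (n + 1) (B.coeffAct (n + 1 + 1) c₀ x))
          = B.coeffAct (n + 1 + 1)
            ((Bimodule.regular A).boundary (n + 1 + 1) (s (n + 1) c₀)) x :=
        (congrArg _ (ht (n + 1) c₀ x)).trans (boundary_coeffAct hB (n + 1 + 1) _ x)
      rw [h₁, h₂, ← _root_.add_apply, ← (B.coeffAct (n + 1 + 1)).map_add, hs n c₀]
    have key : (t n).comp (B.boundary (n + 1)) + (B.boundary (n + 1 + 1)).comp (t (n + 1))
        = ContinuousLinearMap.id ℂ (Chain A M (n + 1 + 1)) := chain_hom_ext fun x a => by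
      rw [hmk (n + 1 + 1) x a]
      exact hcoeff _ x
    refine ⟨t (n + 1) c, ?_⟩
    have h₃ : t n (B.boundary (n + 1) c) + B.boundary (n + 1 + 1) (t (n + 1) c) = c :=
      DFunLike.congr_fun key c
    rw [hc, (t n).map_zero, zero_add] at h₃
    exact h₃

set_option maxHeartbeats 1000000 in
theorem Bimodule.subsingleton_cohomology_of_splits [CompleteSpace M] {B : Bimodule A M}
    (hB : B.IsSymmetric) (hB₁ : B.IsUnitLinked)
    (h : SplitsAsBanachModules (X := fun n => Chain A A (n + 1)) (truncatedAct A)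
      (truncatedBoundary A)) (n : ℕ) :
    Subsingleton (B.Cohomology (n + 1)) := by
  obtain ⟨s, hs₀, hs, hact⟩ := exists_module_homotopy_of_splits h
  rw [Bimodule.subsingleton_cohomology_succ_iff]
  have happly : ∀ (m : ℕ) (F : Cochain A M m) (a : Fin m → A),
      F a = B.cochainExtend F (chainMk A A m 1 a) := fun m F a => by
    rw [cochainExtend_mk, (hB₁ _).1]
  intro F hF
  have hF₁ : ∀ c, B.cochainExtend F ((Bimodule.regular A).boundary (n + 1) c) = 0 := fun c => by
    have h₀ : B.cochainExtend (0 : Cochain A M (n + 1 + 1)) = 0 :=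
      chain_hom_ext fun a₀ a => by simp
    rw [cochainExtend_boundary hB, hF, h₀, _root_.zero_apply]
  cases n with
  | zero =>
    -- In degree one the cocycle itself is zero: its extension kills the boundaries, and `d₁ s₀ =
    -- id` makes every 1-chain a boundary.
    refine ⟨0, ?_⟩
    ext a
    rw [map_zero, happly _ F, ← hs₀ (chainMk A A (0 + 1) 1 a), hF₁, _root_.zero_apply]
  | succ n =>
    -- The primitive is the extended cocycle composed with `s`, restricted to the free generators;
    -- `A`-linearity of `s` recovers the composite from it.
    let G : Cochain A M (n + 1) :=
      ((B.cochainExtend F).comp (s n)).compContinuousMultilinearMap (chainMk A A (n + 1) 1)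
    have hG : B.cochainExtend G = (B.cochainExtend F).comp (s n) := chain_hom_ext fun a₀ a => by
      rw [cochainExtend_mk, chainMk_eq_chainAct, ContinuousLinearMap.comp_apply, hact,
        cochainExtend_chainAct]
      rfl
    refine ⟨G, ?_⟩
    ext a
    rw [happly _ F, happly, ← cochainExtend_boundary hB, hG, ContinuousLinearMap.comp_apply]
    conv_rhs => rw [← hs n (chainMk A A (n + 1 + 1) 1 a)]
    rw [(B.cochainExtend F).map_add, hF₁ (s (n + 1) (chainMk A A (n + 1 + 1) 1 a)), add_zero]

end Splitting

/-! ### Construction of a splitting -/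

section Construction

variable {A : Type u} [NormedCommRing A] [NormedAlgebra ℂ A]

/-- Exactness makes `d` a surjection onto the closed subspace `ker d'`, a Banach space through which
`T` can be lifted. -/
theorem HasLifting.exists_lift_of_exact {E : Type u} [NormedAddCommGroup E] [NormedSpace ℂ E]
    (hE : HasLifting E) {X Y Z : Type u} [NormedAddCommGroup X] [NormedSpace ℂ X] [CompleteSpace X]
    [NormedAddCommGroup Y] [NormedSpace ℂ Y] [CompleteSpace Y]
    [NormedAddCommGroup Z] [NormedSpace ℂ Z] (d : X →L[ℂ] Y) (d' : Y →L[ℂ] Z)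
    (hd : ∀ x, d' (d x) = 0) (hexact : ∀ y, d' y = 0 → ∃ x, d x = y) {n : ℕ}
    (T : E [×n]→L[ℂ] Y) (hT : ∀ a, d' (T a) = 0) :
    ∃ S : E [×n]→L[ℂ] X, ∀ a, d (S a) = T a := by
  obtain ⟨K, hK⟩ : ∃ K : Submodule ℂ Y, K = d'.ker := ⟨_, rfl⟩
  have hmem : ∀ k, k ∈ K ↔ d' k = 0 := fun k => by rw [hK, LinearMap.mem_ker]; rfl
  have hKc : IsClosed (K : Set Y) := by
    have : (K : Set Y) = d' ⁻¹' {0} := by ext k; exact hmem k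
    rw [this]
    exact isClosed_singleton.preimage d'.continuous
  have : CompleteSpace K := hKc.completeSpace_coe
  obtain ⟨S, hS⟩ := hE.multilinear (d.codRestrict K fun x => (hmem _).2 (hd x))
    (fun k => by
      obtain ⟨x, hx⟩ := hexact k ((hmem _).1 k.2)
      exact ⟨x, Subtype.ext hx⟩) n (T.codRestrict K fun a => (hmem _).2 (hT a))
  exact ⟨S, fun a => congrArg Subtype.val (DFunLike.congr_fun hS a)⟩

/-- A module endomorphism of the `(m + 1)`-chains with values in the cycles factors through the
boundary operator. -/
theorem exists_module_lift (hA : HasLifting A) (m : ℕ)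
    (hexact : Subsingleton (SimplicialHomology A (m + 1)))
    (T : Chain A A (m + 1) →L[ℂ] Chain A A (m + 1))
    (hT : ∀ c, (Bimodule.regular A).boundary m (T c) = 0)
    (hTact : ∀ a c, T ((Bimodule.regular A).chainAct (m + 1) a c)
      = (Bimodule.regular A).chainAct (m + 1) a (T c)) :
    ∃ s : Chain A A (m + 1) →L[ℂ] Chain A A (m + 1 + 1),
      (∀ c, (Bimodule.regular A).boundary (m + 1) (s c) = T c) ∧
      ∀ a c, s ((Bimodule.regular A).chainAct (m + 1) a c)
        = (Bimodule.regular A).chainAct (m + 1 + 1) a (s c) := by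
  -- Lifting is done only on the generators `1 ⊗ a`; the `A`-linear extension of `g` is then
  -- automatically a module map, and agreement on generators suffices.
  obtain ⟨g, hg⟩ := hA.exists_lift_of_exact _ _ ((Bimodule.regular A).boundary_boundary m)
    ((Bimodule.subsingleton_homology_succ_iff _ m).1 hexact)
    (T.compContinuousMultilinearMap (chainMk A A (m + 1) 1)) fun a => hT _
  refine ⟨(Bimodule.regular A).extend g, fun c => ?_, regular_extend_chainAct g⟩
  have : ((Bimodule.regular A).boundary (m + 1)).comp ((Bimodule.regular A).extend g) = T :=
    chain_hom_ext fun b a => by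
      rw [ContinuousLinearMap.comp_apply, Bimodule.extend_mk, regular_coeffAct,
        regular_boundary_chainAct, hg, chainMk_eq_chainAct, hTact]
      rfl
  exact DFunLike.congr_fun this c

/-- The recursive construction of a contracting homotopy by module maps. -/
theorem splitsAsBanachModules_of_lifts {R : Type v} {X : ℕ → Type w}
    [∀ n, NormedAddCommGroup (X n)] [∀ n, NormedSpace ℂ (X n)] (d : ∀ n, X (n + 1) →L[ℂ] X n)
    (hdd : ∀ n x, d n (d (n + 1) x) = 0) (act : ∀ n, R → X n →L[ℂ] X n)
    (hdact : ∀ n a x, d n (act (n + 1) a x) = act n a (d n x))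
    (hzero : ∃ s : X 0 →L[ℂ] X 1, (∀ x, d 0 (s x) = x) ∧ ∀ a x, s (act 0 a x) = act 1 a (s x))
    (hsucc : ∀ n (T : X (n + 1) →L[ℂ] X (n + 1)), (∀ x, d n (T x) = 0) →
      (∀ a x, T (act (n + 1) a x) = act (n + 1) a (T x)) →
      ∃ s : X (n + 1) →L[ℂ] X (n + 1 + 1), (∀ x, d (n + 1) (s x) = T x) ∧
        ∀ a x, s (act (n + 1) a x) = act (n + 1 + 1) a (s x)) :
    SplitsAsBanachModules act d := by
  -- The invariant `d s d = d` says precisely that `id - s d` takes values in the cycles, so it can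
  -- be lifted to give the next homotopy. That lift satisfies the invariant again because `d ∘ d =
  -- 0`.
  let Q : ∀ n, (X n →L[ℂ] X (n + 1)) → Prop := fun n s =>
    (∀ a x, s (act n a x) = act (n + 1) a (s x)) ∧ ∀ x, d n (s (d n x)) = d n x
  have hstep : ∀ n s, Q n s → ∃ s', Q (n + 1) s' ∧ ∀ x, s (d n x) + d (n + 1) (s' x) = x := by
    rintro n s ⟨hact, hs⟩
    obtain ⟨s', hs', hact'⟩ := hsucc n (ContinuousLinearMap.id ℂ (X (n + 1)) - s.comp (d n))
      (fun x => by simp [hs]) (fun a x => by simp [hact, hdact])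
    refine ⟨s', ⟨hact', fun x => ?_⟩, fun x => ?_⟩
    · simp [hs', hdd]
    · simp [hs']
  obtain ⟨s₀, hs₀, hact₀⟩ := hzero
  choose next hnext hnext' using hstep
  let σ : ∀ n, {s // Q n s} := fun n =>
    Nat.rec ⟨s₀, hact₀, fun x => hs₀ _⟩ (fun n s => ⟨next n s.1 s.2, hnext n s.1 s.2⟩) n
  exact ⟨fun n => (σ n).1, ⟨ContinuousLinearMap.ext hs₀,
    fun n => ContinuousLinearMap.ext (hnext' n (σ n).1 (σ n).2)⟩, fun n => (σ n).2.1⟩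

theorem splitsAsBanachModules_of_subsingleton_homology (hA : HasLifting A)
    (h : ∀ n, Subsingleton (SimplicialHomology A (n + 1))) :
    SplitsAsBanachModules (X := fun n => Chain A A (n + 1)) (truncatedAct A)
      (truncatedBoundary A) := by
  refine splitsAsBanachModules_of_lifts (X := fun n => Chain A A (n + 1)) (truncatedBoundary A)
    (fun n => (Bimodule.regular A).boundary_boundary (n + 1)) (truncatedAct A)
    (fun n => regular_boundary_chainAct (n + 1)) ?_
    (fun n => exists_module_lift hA (n + 1) (h (n + 1)))
  -- Since `d₀ = 0`, the identity of the 1-chains already takes values in the cycles.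
  exact exists_module_lift hA 0 (h 0) (ContinuousLinearMap.id ℂ (Chain A A (0 + 1)))
    (fun c => by rw [Bimodule.regular_isSymmetric.boundary_zero, _root_.zero_apply])
    fun a c => rfl

end Construction

end BanachHochschild

end

universe u v w

open BanachHochschild in
theorem proposition3p2 (A : Type u) [NormedCommRing A] [NormedAlgebra ℂ A]
    [CompleteSpace A] (Ω : Type w) (e : A ≃L[ℂ] lp (fun _ : Ω => ℂ) 1) :
    List.TFAE
      [∀ n : ℕ, 1 ≤ n → Subsingleton (SimplicialCohomology A n),
       ∀ n : ℕ, 1 ≤ n → Subsingleton (SimplicialHomology A n),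
       SplitsAsBanachSpaces (X := fun n => Chain A A (n + 1)) (truncatedBoundary A),
       SplitsAsBanachModules (X := fun n => Chain A A (n + 1)) (truncatedAct A)
         (truncatedBoundary A),
       ∀ (M : Type (max u v)) [NormedAddCommGroup M] [NormedSpace ℂ M] [CompleteSpace M]
         (B : Bimodule A M), B.IsSymmetric → B.IsUnitLinked →
           ∀ n : ℕ, 1 ≤ n → Subsingleton (B.Cohomology n),
       ∀ (M : Type (max u v)) [NormedAddCommGroup M] [NormedSpace ℂ M] [CompleteSpace M]
         (B : Bimodule A M), B.IsSymmetric → B.IsUnitLinked →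
           ∀ n : ℕ, 1 ≤ n → Subsingleton (B.Homology n)] := by
  simp only [forall_one_le_iff]
  tfae_have 1 → 2 := fun h n => subsingleton_homology_of_dual _ n (h n) (h (n + 1))
  tfae_have 2 → 4 := splitsAsBanachModules_of_subsingleton_homology (hasLifting_of_equiv_lp_one e)
  tfae_have 4 → 3 := fun ⟨s, hs, _⟩ => ⟨s, hs⟩
  tfae_have 3 → 2 := subsingleton_homology_of_splits
  tfae_have 4 → 5 := fun h M _ _ _ B hB hB₁ =>
    Bimodule.subsingleton_cohomology_of_splits hB hB₁ h
  tfae_have 4 → 6 := fun h M _ _ _ B hB hB₁ =>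
    Bimodule.subsingleton_homology_of_splits hB hB₁ h
  -- The coefficient modules range over `Type (max u v)` while `A'` lies in `Type u`, so its
  -- bimodule structure is transported to a universe lift.
  tfae_have 5 → 1 := fun h n =>
    Bimodule.subsingleton_cohomology_of_transport _
      (ContinuousLinearEquiv.ulift : ULift.{max u v} (StrongDual ℂ A) ≃L[ℂ] StrongDual ℂ A) n
      (h _ _ (Bimodule.regular_isSymmetric.dual.transport _)
        (Bimodule.regular_isUnitLinked.dual.transport _) n)
  tfae_have 6 → 2 := fun h n =>
    Bimodule.subsingleton_homology_of_transport _
      (ContinuousLinearEquiv.ulift : ULift.{max u v} A ≃L[ℂ] A) n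
      (h _ _ (Bimodule.regular_isSymmetric.transport _)
        (Bimodule.regular_isUnitLinked.transport _) n)
  tfae_finish
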